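/- **Setting.** Let $A=(Q,q_0,O,R,\sigma)$ with $\sigma:O\times Q\to R\times Q$ be any sequential object. Operations $a,b$ conflict ($a\asymp b$) if in some state $q$ they do not commute, i.e. executing $a$ then $b$ from $q$ and executing $b$ then $a$ from $q$ do not give the same responses and the same final state. Let $n$ processes be given. A command is a triple $(op,i,seq)$ with $op\in O$, $i$ a process and $seq\in\mathbb N$; it is executed as $op$ and inherits the conflicts of $op$. A trace is a class of finite sequences (schedules) of commands, two schedules being equivalent if they have the same multiset of commands and the same order on all pairs of conflicting occurrences. Traces form a monoid under concatenation; $\epsilon$ is the empty trace, $x\le y$ means $y=x\cdot z$ for some trace $z$, $\mathrm{ops}(t)$ is the multiset of commands of $t$, and $\mathsf{ret}^*(cmd,t)$ is the response to $cmd$ when a representative of $t$ is executed from $q_0$. A set of traces is compatible if it has an upper bound. A generalized commit-adopt (GCA) object is a one-shot object: each participant $i\in P$ proposes a trace $s_i$, and each $i\in P_r\subseteq P$ whose call returns obtains a pair $(t_i,c_i)$ of a trace and a Boolean ("$t_i$ is committed" if $c_i=\mathrm{True}$). At every moment of every execution: 1. (Validity) $\mathrm{ops}(t_i)\subseteq\bigcup_{j\in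 P}\mathrm{ops}(s_j)$ as multisets, for $i\in P_r$. 2. (Adoption) If $c_i=\mathrm{True}$, then $t_i\le t_j$ for all $j\in P_r$. 3. (Commitment) If $P=P_r\neq\emptyset$ and the inputs are compatible, then $s_j\le t_j$ and $c_j=\mathrm{True}$ for some $j\in P_r$. 4. (Convergence) The outputs $t_i$, $i\in P_r$, are compatible. 5. (Common prefix) The greatest lower bound of the inputs is a prefix of $t_i$, for all $i\in P_r$. 6. (Weak agreement) If all inputs are equal, then $c_i=\mathrm{True}$ for all $i\in P_r$. **Algorithm.** The processes are asynchronous, may stop at any time, and share GCA objects $\mathrm{GCA}_1,\mathrm{GCA}_2,\dots$ and atomic registers $S[1],\dots,S[n]$, initially $(0,\epsilon)$. To execute an operation $op$, process $i$ increments its counter $seq$ (initially $0$), forms the command $cmd=(op,i,seq)$, sets $c=\mathrm{False}$, reads all the registers $S[j]$ one by one, and takes for $(r,s)$ one of the pairs read with the largest first component. While $cmd\notin\mathrm{ops}(s)$ or $c=\mathrm{False}$, it sets $r:=r+1$, replaces $s$ by $s\cdot cmd$ if $cmd\notin\mathrm{ops}(s)$, and sets $(s,c):=\mathrm{GCA}_r.\mathrm{propose}(s)$.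 Then it writes $S[i]:=(r,s)$ and returns $\mathsf{ret}^*(cmd,s)$. **Theorem.** For every sequential object $A$, every number $n$ of processes and every finite or infinite execution of this algorithm, with history $H$ of invocations and responses of operations of $A$: 1. $H$ is linearizable with respect to $A$: there is a legal sequential history $\mathcal S$ of $A$ consisting of all complete operation instances of $H$, with their responses, and of some pending ones, each completed by a response, such that $\mathcal S$ preserves the order of the instances of each process and the real-time order of $H$. 2. If $t$ is committed at round $r$ (that is, some call to $\mathrm{GCA}_r$ returns $(t,\mathrm{True})$) and $t'$ is returned, committed or not, by a call to $\mathrm{GCA}_{r'}$ with $r'\ge r$, then $t\le t'$. In particular, committed traces grow monotonically across rounds. 3. If $r^*$ is the largest round at which a trace is committed and $t$ is committed at round $r^*$, then $t$ has a representative $\hat t$ in which every command is the command of an invoked operation and occurs once, such that (a) if an operation instance $\Phi_1$ completes in $H$ before $\Phi_2$ is invoked and the command of $\Phi_2$ is in $\hat t$, then the command of $\Phi_1$ is in $\hat t$, before that of $\Phi_2$; and (b) the command of every complete operation instance $\Phi$ is in $\hat t$ and the response of $\Phi$ in $H$ is the response to its command when $\hat t$ is executed from $q_0$. -/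

import Mathlib

namespace ChainedGCA

/-! ### Sequential objects -/

/-- A sequential data type `(Q, q₀, O, R, σ)`. -/
structure SeqObject (Q O R : Type*) where
  init : Q
  step : O → Q → R × Q

namespace SeqObject

variable {Q O R : Type*} (A : SeqObject Q O R)

/-- The operations `a` and `b` commute in the state `q`. -/
def CommuteIn (q : Q) (a b : O) : Prop :=
  ∃ (ra rb : R) (q₁ q₂ q' : Q),
    A.step a q = (ra, q₁) ∧ A.step b q₁ = (rb, q') ∧
    A.step b q = (rb, q₂) ∧ A.step a q₂ = (ra, q')

/-- The conflict relation: there is a state in which `a` and `b` do not commute. -/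
def Conflict (a b : O) : Prop := ∃ q, ¬ A.CommuteIn q a b

theorem CommuteIn.symm {q : Q} {a b : O} (h : A.CommuteIn q a b) : A.CommuteIn q b a := by
  obtain ⟨ra, rb, q₁, q₂, q', h1, h2, h3, h4⟩ := h
  exact ⟨rb, ra, q₂, q₁, q', h3, h4, h1, h2⟩

theorem Conflict.symm {a b : O} (h : A.Conflict a b) : A.Conflict b a := by
  obtain ⟨q, hq⟩ := h
  exact ⟨q, fun h' => hq h'.symm⟩

/-- `σ*`: the responses and states obtained by executing a schedule from a state. -/
def run : List O → Q → List (R × Q)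
  | [], _ => []
  | o :: s, q => A.step o q :: run s (A.step o q).2

end SeqObject

/-! ### Occurrences of operations in schedules -/

section Schedules

variable {O : Type*}

open Classical in
/-- The `i`-th occurrence `o⁽ⁱ⁾` of `o` in the schedule `s` (counted from `i = 1`) is at
position `k` (counted from `k = 0`). -/
def OccursAt (s : List O) (o : O) (i k : ℕ) : Prop :=
  s[k]? = some o ∧ (s.take (k + 1)).count o = i

/-- `a⁽ⁱ⁾ ≺ₛ b⁽ʲ⁾`. -/
def Prec (s : List O) (a : O) (i : ℕ) (b : O) (j : ℕ) : Prop :=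
  ∃ k l, OccursAt s a i k ∧ OccursAt s b j l ∧ k < l

theorem OccursAt.lt {s : List O} {o : O} {i k : ℕ} (h : OccursAt s o i k) : k < s.length := by
  by_contra hk
  have h1 := h.1
  rw [List.getElem?_eq_none (by omega)] at h1
  exact absurd h1 (by simp)

open Classical in
theorem OccursAt.count_take {s : List O} {o : O} {i k : ℕ} (h : OccursAt s o i k) :
    (s.take k).count o + 1 = i := by
  obtain ⟨h1, h2⟩ := h
  rw [List.take_add_one, h1] at h2
  simpa using h2

open Classical in
theorem OccursAt.unique {s : List O} {o : O} {i k k' : ℕ} (h : OccursAt s o i k)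
    (h' : OccursAt s o i k') : k = k' := by
  have key : ∀ {k k' : ℕ}, OccursAt s o i k → OccursAt s o i k' → ¬ k < k' := by
    intro k k' h h' hlt
    have h1 := h'.count_take
    have h2 : (s.take (k + 1)).count o ≤ (s.take k').count o :=
      (List.take_sublist_take_left (by omega)).count_le o
    have h3 := h.2
    omega
  have := key h h'
  have := key h' h
  omega

open Classical in
theorem occursAt_append {x y : List O} {o : O} {i k : ℕ} :
    OccursAt (x ++ y) o i k ↔ OccursAt x o i k ∨
      ∃ i' k', i = x.count o + i' ∧ k = x.length + k' ∧ OccursAt y o i' k' := by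
  unfold OccursAt
  rcases lt_or_ge k x.length with hk | hk
  · rw [List.getElem?_append_left hk, List.take_append_of_le_length (by omega)]
    constructor
    · exact Or.inl
    · rintro (h | ⟨i', k', -, hk', -⟩)
      · exact h
      · omega
  · obtain ⟨m, rfl⟩ := Nat.exists_eq_add_of_le hk
    rw [List.getElem?_append_right hk, List.take_append, List.take_of_length_le (by omega),
      List.count_append, List.getElem?_eq_none hk]
    have e1 : x.length + m - x.length = m := by omega
    have e2 : x.length + m + 1 - x.length = m + 1 := by omega
    rw [e1, e2]
    constructor
    · rintro ⟨h1, h2⟩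
      exact Or.inr ⟨_, m, h2.symm, rfl, h1, rfl⟩
    · rintro (⟨h, -⟩ | ⟨i', k', h1, h2, h3, h4⟩)
      · exact absurd h (by simp)
      · obtain rfl : m = k' := by omega
        exact ⟨h3, by omega⟩

open Classical in
theorem exists_occursAt {s : List O} {o : O} {i : ℕ} :
    (∃ k, OccursAt s o i k) ↔ 1 ≤ i ∧ i ≤ s.count o := by
  constructor
  · rintro ⟨k, h⟩
    have h1 := h.count_take
    have h2 : (s.take (k + 1)).count o ≤ s.count o := (List.take_sublist _ _).count_le o
    have h3 := h.2
    omega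
  · induction s using List.reverseRecOn with
    | nil => rintro ⟨h1, h2⟩; simp at h2; omega
    | append_singleton x a ih =>
      rintro ⟨h1, h2⟩
      rcases le_or_gt i (x.count o) with h | h
      · obtain ⟨k, hk⟩ := ih ⟨h1, h⟩
        exact ⟨k, occursAt_append.2 (Or.inl hk)⟩
      · rw [List.count_append] at h2
        have hao : a = o := by
          by_contra hne
          rw [List.count_singleton] at h2
          simp [hne] at h2
          omega
        subst hao
        refine ⟨x.length, occursAt_append.2 (Or.inr ⟨1, 0, ?_, rfl, ?_⟩)⟩
        · simp at h2; omega
        · simp [OccursAt]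

end Schedules

/-! ### Traces -/

namespace SeqObject

variable {Q O R : Type*} (A : SeqObject Q O R)

/-- Two schedules are equivalent if they contain the same operations, and every precedence
between conflicting occurrences is preserved. -/
def SchedEquiv (s s' : List O) : Prop :=
  (s : Multiset O) = (s' : Multiset O) ∧
    ∀ (a b : O) (i j : ℕ), A.Conflict a b → Prec s a i b j → Prec s' a i b j

theorem SchedEquiv.exists_occursAt {s s' : List O} (h : A.SchedEquiv s s') {o : O} {i k : ℕ}
    (hk : OccursAt s o i k) : ∃ k', OccursAt s' o i k' := by
  classical
  have h1 := ChainedGCA.exists_occursAt.1 ⟨k, hk⟩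
  rw [(Multiset.coe_eq_coe.1 h.1).count_eq] at h1
  exact ChainedGCA.exists_occursAt.2 h1

theorem SchedEquiv.ops_eq {A : SeqObject Q O R} {s s' : List O} (h : A.SchedEquiv s s') :
    (s : Multiset O) = (s' : Multiset O) := h.1

theorem SchedEquiv.refl (s : List O) : A.SchedEquiv s s := ⟨rfl, fun _ _ _ _ _ h => h⟩

theorem SchedEquiv.trans {s s' s'' : List O} (h : A.SchedEquiv s s') (h' : A.SchedEquiv s' s'') :
    A.SchedEquiv s s'' :=
  ⟨h.1.trans h'.1, fun a b i j hab hp => h'.2 a b i j hab (h.2 a b i j hab hp)⟩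

theorem SchedEquiv.symm {s s' : List O} (h : A.SchedEquiv s s') : A.SchedEquiv s' s := by
  classical
  refine ⟨h.1.symm, ?_⟩
  rintro a b i j hab ⟨k', l', hk', hl', hlt⟩
  have hex : ∀ {o : O} {i k : ℕ}, OccursAt s' o i k → ∃ k', OccursAt s o i k' := by
    intro o i k hk
    have h1 := ChainedGCA.exists_occursAt.1 ⟨k, hk⟩
    rw [← (Multiset.coe_eq_coe.1 h.1).count_eq] at h1
    exact ChainedGCA.exists_occursAt.2 h1
  obtain ⟨k, hk⟩ := hex hk'
  obtain ⟨l, hl⟩ := hex hl'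
  rcases lt_trichotomy k l with hkl | hkl | hkl
  · exact ⟨k, l, hk, hl, hkl⟩
  · exfalso
    subst hkl
    have e : a = b := Option.some.inj (hk.1.symm.trans hl.1)
    subst e
    have e' : i = j := hk.2.symm.trans hl.2
    subst e'
    have := hk'.unique hl'
    omega
  · exfalso
    obtain ⟨l'', k'', h1, h2, h3⟩ := h.2 b a j i (Conflict.symm A hab) ⟨l, k, hl, hk, hkl⟩
    have := h1.unique hl'
    have := h2.unique hk'
    omega

theorem SchedEquiv.append {x x' y y' : List O} (hx : A.SchedEquiv x x')
    (hy : A.SchedEquiv y y') : A.SchedEquiv (x ++ y) (x' ++ y') := by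
  classical
  have hpx := Multiset.coe_eq_coe.1 hx.1
  have hpy := Multiset.coe_eq_coe.1 hy.1
  refine ⟨Multiset.coe_eq_coe.2 (hpx.append hpy), ?_⟩
  rintro a b i j hab ⟨k, l, hk, hl, hlt⟩
  rcases occursAt_append.1 hk with hk₁ | ⟨i', k', rfl, rfl, hk₁⟩ <;>
    rcases occursAt_append.1 hl with hl₁ | ⟨j', l', rfl, rfl, hl₁⟩
  · obtain ⟨k₁, l₁, h1, h2, h3⟩ := hx.2 a b i j hab ⟨k, l, hk₁, hl₁, hlt⟩
    exact ⟨k₁, l₁, occursAt_append.2 (Or.inl h1), occursAt_append.2 (Or.inl h2), h3⟩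
  · obtain ⟨k₁, h1⟩ := hx.exists_occursAt A hk₁
    obtain ⟨l₁, h2⟩ := hy.exists_occursAt A hl₁
    refine ⟨k₁, x'.length + l₁, occursAt_append.2 (Or.inl h1),
      occursAt_append.2 (Or.inr ⟨j', l₁, ?_, rfl, h2⟩), ?_⟩
    · rw [hpx.count_eq]
    · have := h1.lt
      omega
  · have := hl₁.lt
    omega
  · obtain ⟨k₁, l₁, h1, h2, h3⟩ := hy.2 a b i' j' hab ⟨k', l', hk₁, hl₁, by omega⟩
    refine ⟨x'.length + k₁, x'.length + l₁, occursAt_append.2 (Or.inr ⟨i', k₁, ?_, rfl, h1⟩),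
      occursAt_append.2 (Or.inr ⟨j', l₁, ?_, rfl, h2⟩), by omega⟩
    · rw [hpx.count_eq]
    · rw [hpx.count_eq]

/-- The equivalence of schedules. -/
def schedSetoid : Setoid (List O) where
  r := A.SchedEquiv
  iseqv := ⟨SchedEquiv.refl A, fun h => h.symm A, fun h h' => h.trans A h'⟩

/-- Traces: equivalence classes of schedules. -/
def Trace : Type _ := Quotient A.schedSetoid

/-- The trace `[s]` of a schedule `s`. -/
def traceOf (s : List O) : A.Trace := Quotient.mk A.schedSetoid s

namespace Trace

variable {A}

/-- The multiset of operations of a trace. -/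
def ops (t : A.Trace) : Multiset O :=
  Quotient.lift (s := A.schedSetoid) (fun s : List O => (s : Multiset O))
    (fun _ _ h => SchedEquiv.ops_eq h) t

/-- The quotient monoid of traces under concatenation; `1` is the empty trace. -/
instance : Monoid A.Trace where
  one := A.traceOf []
  mul := Quotient.map₂ (fun s s' : List O => s ++ s')
    (fun _ _ hx _ _ hy => SchedEquiv.append A hx hy)
  mul_assoc := by
    rintro ⟨x⟩ ⟨y⟩ ⟨z⟩
    exact congrArg A.traceOf (List.append_assoc x y z)
  one_mul := by
    rintro ⟨x⟩
    rfl
  mul_one := by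
    rintro ⟨x⟩
    exact congrArg A.traceOf (List.append_nil x)

theorem mk_mul_mk (x y : List O) : A.traceOf x * A.traceOf y = A.traceOf (x ++ y) := rfl

theorem ops_mul (x y : A.Trace) : (x * y).ops = x.ops + y.ops := by
  obtain ⟨x⟩ := x
  obtain ⟨y⟩ := y
  exact (Multiset.coe_add x y).symm

theorem eq_one_of_ops_eq_zero {x : A.Trace} (h : x.ops = 0) : x = 1 := by
  obtain ⟨x⟩ := x
  have hx : x = [] := Multiset.coe_eq_zero x |>.1 h
  subst hx
  rfl

/-- The prefix order: `x ≤ y` if `y = x · z` for some trace `z`. -/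
instance : PartialOrder A.Trace where
  le x y := ∃ z, y = x * z
  le_refl x := ⟨1, (mul_one x).symm⟩
  le_trans := by
    rintro x _ _ ⟨u, rfl⟩ ⟨v, rfl⟩
    exact ⟨u * v, mul_assoc x u v⟩
  le_antisymm := by
    rintro x y ⟨u, rfl⟩ ⟨v, hv⟩
    have h : x.ops + (u.ops + v.ops) = x.ops + 0 := by
      rw [← add_assoc, ← ops_mul, ← ops_mul, ← hv, add_zero]
    have hu := eq_one_of_ops_eq_zero (add_eq_zero.1 (add_left_cancel h)).1
    rw [hu, mul_one]

end Trace

/-- `ρ` is the return value `ret*(o⁽ⁱ⁾, s)` of the `i`-th occurrence of `o` in the schedule `s`,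
executed from the initial state. -/
def RetSched (s : List O) (o : O) (i : ℕ) (ρ : R) : Prop :=
  ∃ k q, OccursAt s o i k ∧ (A.run s A.init)[k]? = some (ρ, q)

/-- `ρ` is the return value `ret*(o⁽ⁱ⁾, t)` of the `i`-th occurrence of `o` in the trace `t`,
computed in an arbitrary representative of `t`. -/
def RetTrace (t : A.Trace) (o : O) (i : ℕ) (ρ : R) : Prop :=
  ∃ s, A.traceOf s = t ∧ A.RetSched s o i ρ

end SeqObject

/-! ### Generalized commit-adopt -/

/-- What has happened at a one-shot GCA instance: `inp i` is the input of process `i` if `i` has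
invoked `propose`, and `out i` is the pair returned to `i` if its call has returned. -/
structure GCAState (n : ℕ) (T : Type*) where
  inp : Fin n → Option T
  out : Fin n → Option (T × Bool)

namespace GCAState

variable {Q O R : Type*} {A : SeqObject Q O R} {n : ℕ}

/-- The set of input traces. -/
def inputs (g : GCAState n A.Trace) : Set A.Trace := {s | ∃ i, g.inp i = some s}

/-- The set of output traces. -/
def outputs (g : GCAState n A.Trace) : Set A.Trace := {t | ∃ i c, g.out i = some (t, c)}

open Classical in
/-- The properties of generalized commit-adopt.  In `validity`, the inclusion in the union is the
one of multisets: each operation is at most as frequent in the output as in some input. -/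
structure Spec (g : GCAState n A.Trace) : Prop where
  validity : ∀ i t c, g.out i = some (t, c) →
    ∀ o, ∃ s ∈ g.inputs, t.ops.count o ≤ s.ops.count o
  adoption : ∀ i t, g.out i = some (t, true) → ∀ t' ∈ g.outputs, t ≤ t'
  commitment : g.inputs.Nonempty → BddAbove g.inputs →
    (∀ i, (g.inp i).isSome → (g.out i).isSome) →
    ∃ i s t, g.inp i = some s ∧ g.out i = some (t, true) ∧ s ≤ t
  convergence : BddAbove g.outputs
  commonPrefix : ∀ e, IsGLB g.inputs e → ∀ t ∈ g.outputs, e ≤ t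
  weakAgreement : g.inputs.Subsingleton → ∀ i t c, g.out i = some (t, c) → c = true

end GCAState

/-! ### Histories and linearizability -/

/-- Invocations and responses on the implemented object. -/
inductive Event (n : ℕ) (O R : Type*) where
  | inv (i : Fin n) (o : O)
  | res (i : Fin n) (ρ : R)

/-- The process of an event. -/
def Event.proc {n : ℕ} {O R : Type*} : Event n O R → Fin n
  | .inv i _ => i
  | .res i _ => i

/-- A finite or infinite history: `H k` is the event at time `k`, if there is one.  An operation
instance of `H` is identified with the time of its invocation. -/
abbrev History (n : ℕ) (O R : Type*) := ℕ → Option (Event n O R)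

namespace History

variable {n : ℕ} {Q O R : Type*}

/-- The operation instance invoked at time `k` completes at time `m` with the response `ρ`: this
is the next event of the same process. -/
def Completes (H : History n O R) (k m : ℕ) (ρ : R) : Prop :=
  ∃ i o, H k = some (.inv i o) ∧ H m = some (.res i ρ) ∧ k < m ∧
    ∀ l, k < l → l < m → ∀ e, H l = some e → e.proc ≠ i

/-- Real-time order: the instance invoked at `k` completes before the one at `k'` is invoked. -/
def Precedes (H : History n O R) (k k' : ℕ) : Prop :=
  ∃ m ρ, H.Completes k m ρ ∧ m < k' ∧ ∃ i o, H k' = some (.inv i o)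

/-- `S` is a linearization of `H`.  `S` is the sequential history, a finite or infinite sequence of
operation instances of `H` (named by their invocation times), each with its response.  The
completion of `H` consists of the instances in `S`: all complete ones, with their responses, and
some of the pending ones. -/
structure IsLinearization (A : SeqObject Q O R) (H : History n O R)
    (S : ℕ → Option (ℕ × R)) : Prop where
  /-- `S` is a sequence. -/
  initial : ∀ p, S p = none → S (p + 1) = none
  /-- Every entry is an operation instance of `H`. -/
  invoked : ∀ p k ρ, S p = some (k, ρ) → ∃ i o, H k = some (.inv i o)
  /-- Every instance appears at most once. -/
  once : ∀ p p' k ρ ρ', S p = some (k, ρ) → S p' = some (k, ρ') → p = p'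
  /-- Every complete instance appears with its response. -/
  complete : ∀ k m ρ, H.Completes k m ρ → ∃ p, S p = some (k, ρ)
  /-- `S` is legal: its responses are those of the sequential object. -/
  legal : ∃ q : ℕ → Q, q 0 = A.init ∧ ∀ p k ρ i o, S p = some (k, ρ) →
    H k = some (.inv i o) → A.step o (q p) = (ρ, q (p + 1))
  /-- The order of the instances of each process is the one of `H`. -/
  program : ∀ p p' k k' ρ ρ' i o o', S p = some (k, ρ) → S p' = some (k', ρ') →
    H k = some (.inv i o) → H k' = some (.inv i o') → k < k' → p < p'
  /-- The real-time order of `H` is preserved. -/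
  realTime : ∀ p p' k k' ρ ρ', S p = some (k, ρ) → S p' = some (k', ρ') →
    H.Precedes k k' → p < p'

/-- `H` is linearizable with respect to `A`. -/
def Linearizable (A : SeqObject Q O R) (H : History n O R) : Prop :=
  ∃ S, H.IsLinearization A S

end History

/-! ### The universal construction -/

/-- A command `(op, i, seq)`. -/
structure Cmd (n : ℕ) (O : Type*) where
  op : O
  proc : Fin n
  seq : ℕ

/-- The object derived from `A` whose operations are the commands. -/
def SeqObject.cmdObject {Q O R : Type*} (A : SeqObject Q O R) (n : ℕ) :
    SeqObject Q (Cmd n O) R where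
  init := A.init
  step c q := A.step c.op q

section Algorithm

variable {Q O R : Type*} (A : SeqObject Q O R) (n : ℕ)

/-- Traces of commands. -/
abbrev CTrace := (A.cmdObject n).Trace

/-- The point a process has reached in its code. -/
inductive Loc where
  /-- No pending operation. -/
  | idle
  /-- Reading the array `S` one register at a time; `view j` is the value read from `S[j]`. -/
  | collect (cmd : Cmd n O) (view : Fin n → Option (ℕ × CTrace A n))
  /-- At the test of the `while` loop, with the local variables `r`, `s`, `c`. -/
  | loop (cmd : Cmd n O) (r : ℕ) (s : CTrace A n) (c : Bool)
  /-- Inside the call `GCA_r.propose`. -/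
  | inGCA (cmd : Cmd n O) (r : ℕ)
  /-- About to return, after the write to `S[i]`. -/
  | done (cmd : Cmd n O) (s : CTrace A n)

/-- A configuration: the locations and sequence numbers of the processes, the array of registers
`S`, and the GCA instances. -/
structure Config where
  loc : Fin n → Loc A n
  seq : Fin n → ℕ
  S : Fin n → ℕ × CTrace A n
  gca : ℕ → GCAState n (CTrace A n)

/-- The initial configuration. -/
def Config.initial : Config A n where
  loc _ := .idle
  seq _ := 0
  S _ := (0, 1)
  gca _ := ⟨fun _ => none, fun _ => none⟩

/-- Labels of steps. -/
inductive Label where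
  | invoke (cmd : Cmd n O)
  | respond (i : Fin n) (ρ : R)
  /-- The call `GCA_r.propose` of process `i` returns `(t, c)`. -/
  | gcaReturn (i : Fin n) (r : ℕ) (t : CTrace A n) (c : Bool)
  | internal

variable {A n}

open Classical in
/-- The steps of the algorithm. -/
inductive Step : Config A n → Label A n → Config A n → Prop
  /-- Nothing happens. -/
  | idle (C : Config A n) : Step C .internal C
  /-- Process `i` invokes `op` and creates its command. -/
  | invoke (C : Config A n) (i : Fin n) (op : O) (h : C.loc i = .idle) :
      Step C (.invoke ⟨op, i, C.seq i + 1⟩)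
        { C with
          loc := Function.update C.loc i (.collect ⟨op, i, C.seq i + 1⟩ fun _ => none)
          seq := Function.update C.seq i (C.seq i + 1) }
  /-- Process `i` reads the register `S[j]`. -/
  | read (C : Config A n) (i j : Fin n) (cmd : Cmd n O) (view : Fin n → Option (ℕ × CTrace A n))
      (h : C.loc i = .collect cmd view) (hj : view j = none) :
      Step C .internal
        { C with
          loc := Function.update C.loc i
            (.collect cmd (Function.update view j (some (C.S j)))) }
  /-- Having read all the registers, process `i` selects a pair with maximal round. -/
  | select (C : Config A n) (i j : Fin n) (cmd : Cmd n O) (view : Fin n → ℕ × CTrace A n)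
      (h : C.loc i = .collect cmd fun j' => some (view j'))
      (hmax : ∀ j', (view j').1 ≤ (view j).1) :
      Step C .internal
        { C with loc := Function.update C.loc i (.loop cmd (view j).1 (view j).2 false) }
  /-- An iteration of the loop begins: process `i` increments its round, appends its command if it
  is absent, and invokes `propose`. -/
  | propose (C : Config A n) (i : Fin n) (cmd : Cmd n O) (r : ℕ) (s : CTrace A n) (c : Bool)
      (h : C.loc i = .loop cmd r s c) (hc : cmd ∉ s.ops ∨ c = false) :
      Step C .internal
        { C with
          loc := Function.update C.loc i (.inGCA cmd (r + 1))
          gca := Function.update C.gca (r + 1)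
            { C.gca (r + 1) with
              inp := Function.update (C.gca (r + 1)).inp i
                (some (if cmd ∉ s.ops then s * (A.cmdObject n).traceOf [cmd] else s)) } }
  /-- The call of process `i` to `GCA_r` returns a pair, arbitrary subject to the properties
  of GCA. -/
  | gcaReturn (C : Config A n) (i : Fin n) (cmd : Cmd n O) (r : ℕ) (t : CTrace A n) (c : Bool)
      (g : GCAState n (CTrace A n)) (h : C.loc i = .inGCA cmd r)
      (hg : g = { C.gca r with out := Function.update (C.gca r).out i (some (t, c)) })
      (hspec : g.Spec) :
      Step C (.gcaReturn i r t c)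
        { C with
          loc := Function.update C.loc i (.loop cmd r t c)
          gca := Function.update C.gca r g }
  /-- Process `i` leaves the loop and writes `S[i]`. -/
  | write (C : Config A n) (i : Fin n) (cmd : Cmd n O) (r : ℕ) (s : CTrace A n) (c : Bool)
      (h : C.loc i = .loop cmd r s c) (hc : ¬ (cmd ∉ s.ops ∨ c = false)) :
      Step C .internal
        { C with
          loc := Function.update C.loc i (.done cmd s)
          S := Function.update C.S i (r, s) }
  /-- Process `i` returns `ret*(cmd, s)`. -/
  | respond (C : Config A n) (i : Fin n) (cmd : Cmd n O) (s : CTrace A n) (ρ : R)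
      (h : C.loc i = .done cmd s) (hρ : (A.cmdObject n).RetTrace s cmd 1 ρ) :
      Step C (.respond i ρ) { C with loc := Function.update C.loc i .idle }

variable (A n)

/-- An execution of the algorithm by `n` processes.  A finite execution is one in which nothing
happens from some time on. -/
structure Execution where
  config : ℕ → Config A n
  label : ℕ → Label A n
  start : config 0 = Config.initial A n
  step : ∀ k, Step (config k) (label k) (config (k + 1))

variable {A n}

/-- The event on the implemented object that a step produces. -/
def Label.event : Label A n → Option (Event n O R)
  | .invoke cmd => some (.inv cmd.proc cmd.op)
  | .respond i ρ => some (.res i ρ)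
  | _ => none

namespace Execution

variable (α : Execution A n)

/-- The history of an execution. -/
def history : History n O R := fun k => (α.label k).event

/-- Some call to `GCA_r` returns the trace `t`, committed or adopted. -/
def Returned (r : ℕ) (t : CTrace A n) : Prop := ∃ k i c, α.label k = .gcaReturn i r t c

/-- The trace `t` is committed at round `r`: some call to `GCA_r` returns `(t, True)`. -/
def Committed (r : ℕ) (t : CTrace A n) : Prop := ∃ k i, α.label k = .gcaReturn i r t true

end Execution

end Algorithm

end ChainedGCA

namespace ChainedGCA

/-! ### Occurrences in concatenations -/

section Schedules

variable {O : Type*}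

/-! Committed traces form a chain. If `t` is committed at round `r`, adoption makes it a prefix of
every output of round `r`. Every input of round `r + 1` extends an output of round `r`, because a
register only holds a trace together with a round at which it was committed. So `t` is a lower bound
of the inputs of round `r + 1`, and common prefix puts it below the outputs of that round; induction
on the round gives the second claim (`Config.le_of_committed`). The step from the greatest lower
bound to an arbitrary lower bound needs meets of traces to exist (`exists_isGLB`). This is shown by
describing the prefix order through projections on pairs of equal or conflicting operations
(`schedEquiv_append_iff_proj`).

The chain of traces lifts to a chain of schedules, each a literal prefix of the next
(`exists_commitChain`). Its limit is the linearization. Validity bounds multiplicities by those of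
one input, so no command is duplicated. Responses do not depend on the representative
(`SchedEquiv.retFrom`) and survive extension of the schedule, so every response computed from a
committed trace is the one in the limit.

For real time, suppose that an instance with command `cmd` completes before `cmd'` is invoked. The
process of `cmd` has written a round `r₁` whose committed trace contains `cmd`. The process of
`cmd'` reads that register later, starts at a round at least `r₁` and first proposes after it; by
validity `cmd'` is in no trace returned up to `r₁` (`Returned.not_mem`). Thus `cmd` lies in the
schedule of round `r₁` and `cmd'` can only be appended to it later. -/

theorem OccursAt.pos {s : List O} {o : O} {i k : ℕ} (h : OccursAt s o i k) : 1 ≤ i :=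
  (exists_occursAt.1 ⟨k, h⟩).1

theorem OccursAt.mem {s : List O} {o : O} {i k : ℕ} (h : OccursAt s o i k) : o ∈ s :=
  List.mem_of_getElem? h.1

theorem exists_occursAt_one {s : List O} {o : O} (h : o ∈ s) : ∃ k, OccursAt s o 1 k := by
  classical
  exact exists_occursAt.2 ⟨le_rfl, List.count_pos_iff.2 h⟩

theorem occursAt_singleton {a o : O} {i k : ℕ} :
    OccursAt [a] o i k ↔ o = a ∧ i = 1 ∧ k = 0 := by
  classical
  constructor
  · intro h
    have hk : k = 0 := by simpa using h.lt
    subst hk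
    obtain ⟨h1, h2⟩ := h
    obtain rfl : a = o := by simpa using h1
    simp at h2
    exact ⟨rfl, h2.symm, rfl⟩
  · rintro ⟨rfl, rfl, rfl⟩
    simp [OccursAt]

open Classical in
theorem occursAt_cons {a o : O} {x : List O} {i k : ℕ} :
    OccursAt (a :: x) o i k ↔ (o = a ∧ i = 1 ∧ k = 0) ∨
      ∃ i' k', i = [a].count o + i' ∧ k = k' + 1 ∧ OccursAt x o i' k' := by
  rw [← List.singleton_append, occursAt_append, occursAt_singleton]
  simp only [List.length_singleton, add_comm 1]

theorem occursAt_one_of_nodup {s : List O} (hs : s.Nodup) {o : O} {k : ℕ}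
    (h : s[k]? = some o) : OccursAt s o 1 k := by
  classical
  refine ⟨h, le_antisymm ?_ ?_⟩
  · exact List.nodup_iff_count_le_one.1 (hs.sublist (List.take_sublist _ _)) o
  · refine List.count_pos_iff.2 (List.mem_of_getElem? (i := k) ?_)
    rw [List.getElem?_take_of_lt (by omega), h]

end Schedules

namespace SeqObject

variable {Q O R : Type*} (A : SeqObject Q O R)

/-! ### Projections of schedules on pairs of operations -/

open Classical in
/-- The subsequence of the occurrences of `a` and `b`. -/
noncomputable def proj (a b : O) (s : List O) : List O := s.filter fun x => x = a ∨ x = b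

/-- Operations whose occurrences have the same order in all equivalent schedules. -/
def Dependent (a b : O) : Prop := a = b ∨ A.Conflict a b

@[simp]
theorem proj_append (a b : O) (x y : List O) : proj a b (x ++ y) = proj a b x ++ proj a b y := by
  simp [proj]

@[simp]
theorem proj_nil (a b : O) : proj a b [] = [] := rfl

theorem proj_cons (a b c : O) (x : List O) : proj a b (c :: x) = proj a b [c] ++ proj a b x := by
  rw [← proj_append]; rfl

theorem proj_eq_nil {a b : O} {x : List O} : proj a b x = [] ↔ a ∉ x ∧ b ∉ x := by
  simp only [proj, List.filter_eq_nil_iff, decide_eq_true_eq, not_or]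
  constructor
  · intro h
    exact ⟨fun ha => (h a ha).1 rfl, fun hb => (h b hb).2 rfl⟩
  · rintro ⟨h1, h2⟩ c hc
    exact ⟨fun h => h1 (h ▸ hc), fun h => h2 (h ▸ hc)⟩

theorem proj_comm (a b : O) (x : List O) : proj a b x = proj b a x := by
  exact List.filter_congr fun c _ => decide_eq_decide.2 or_comm

theorem mem_proj_left {a b : O} {x : List O} : a ∈ proj a b x ↔ a ∈ x := by
  simp [proj]

theorem proj_cons_left (a b : O) (x : List O) : proj a b (a :: x) = a :: proj a b x := by
  simp [proj]

theorem proj_cons_of_ne {a b c : O} (h1 : c ≠ a) (h2 : c ≠ b) (x : List O) :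
    proj a b (c :: x) = proj a b x := by
  simp [proj, h1, h2]

variable {A}

theorem Dependent.symm {a b : O} (h : A.Dependent a b) : A.Dependent b a :=
  h.elim (fun h => Or.inl h.symm) fun h => Or.inr (Conflict.symm A h)

theorem SchedEquiv.perm {s s' : List O} (h : A.SchedEquiv s s') : s.Perm s' :=
  Multiset.coe_eq_coe.1 h.1

theorem SchedEquiv.cons {s s' : List O} (a : O) (h : A.SchedEquiv s s') :
    A.SchedEquiv (a :: s) (a :: s') :=
  SchedEquiv.append A (SchedEquiv.refl A [a]) h

/-- An operation absent from `p` moves over `p` if it has no conflicts in `p`. -/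
theorem schedEquiv_move_front {a : O} {p : List O} (hp : a ∉ p)
    (hc : ∀ b ∈ p, ¬ A.Conflict a b) (q : List O) :
    A.SchedEquiv (p ++ a :: q) (a :: (p ++ q)) := by
  classical
  have key : A.SchedEquiv (p ++ [a]) ([a] ++ p) := by
    refine ⟨Multiset.coe_eq_coe.2 List.perm_append_comm, ?_⟩
    rintro c d i j hcd ⟨k, l, hk, hl, hlt⟩
    rcases occursAt_append.1 hk with hk₁ | ⟨i', k', rfl, rfl, hk₁⟩
    · rcases occursAt_append.1 hl with hl₁ | ⟨j', l', rfl, rfl, hl₁⟩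
      · have hca : c ≠ a := fun h => hp (h ▸ hk₁.mem)
        have hda : d ≠ a := fun h => hp (h ▸ hl₁.mem)
        refine ⟨1 + k, 1 + l, occursAt_append.2 (Or.inr ⟨i, k, ?_, rfl, hk₁⟩),
          occursAt_append.2 (Or.inr ⟨j, l, ?_, rfl, hl₁⟩), by omega⟩
        · simp [hca.symm]
        · simp [hda.symm]
      · obtain ⟨rfl, -, -⟩ := occursAt_singleton.1 hl₁
        exact absurd (Conflict.symm A hcd) (hc c hk₁.mem)
    · rcases occursAt_append.1 hl with hl₁ | ⟨j', l', rfl, rfl, hl₁⟩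
      · have := hl₁.lt
        omega
      · obtain ⟨-, -, rfl⟩ := occursAt_singleton.1 hk₁
        obtain ⟨-, -, rfl⟩ := occursAt_singleton.1 hl₁
        omega
  simpa using SchedEquiv.append A key (SchedEquiv.refl A q)

/-- Prepending `a` shifts all positions by one and the occurrence numbers of each operation by a
constant, so precedences can be carried to the longer schedules and back. -/
theorem SchedEquiv.of_cons {a : O} {u v : List O} (h : A.SchedEquiv (a :: u) (a :: v)) :
    A.SchedEquiv u v := by
  classical
  refine ⟨Multiset.coe_eq_coe.2 h.perm.cons_inv, ?_⟩
  rintro c d i j hcd ⟨k, l, hk, hl, hlt⟩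
  obtain ⟨k₁, l₁, h1, h2, h3⟩ := h.2 c d ([a].count c + i) ([a].count d + j) hcd
    ⟨k + 1, l + 1, occursAt_cons.2 (Or.inr ⟨i, k, rfl, rfl, hk⟩),
      occursAt_cons.2 (Or.inr ⟨j, l, rfl, rfl, hl⟩), by omega⟩
  -- Since `1 ≤ i`, the shifted occurrence is not the leading `a`, which has number `1`.
  have key : ∀ {o : O} {i k : ℕ}, 1 ≤ i → OccursAt (a :: v) o ([a].count o + i) k →
      ∃ k', k = k' + 1 ∧ OccursAt v o i k' := by
    intro o i k hi ho
    rcases occursAt_cons.1 ho with ⟨rfl, h, -⟩ | ⟨i', k', h, rfl, ho'⟩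
    · simp at h
      omega
    · obtain rfl : i = i' := by omega
      exact ⟨k', rfl, ho'⟩
  obtain ⟨k₂, rfl, hk₂⟩ := key hk.pos h1
  obtain ⟨l₂, rfl, hl₂⟩ := key hl.pos h2
  exact ⟨k₂, l₂, hk₂, hl₂, by omega⟩

/-- The first `a` of `x` corresponds to the leading one, which precedes everything; a conflicting
operation before it in `x` would reverse an order. This is the induction principle for equivalent
schedules. -/
theorem SchedEquiv.exists_of_cons {a : O} {u x : List O} (h : A.SchedEquiv (a :: u) x) :
    ∃ p q, x = p ++ a :: q ∧ a ∉ p ∧ (∀ b ∈ p, ¬ A.Conflict a b) ∧ A.SchedEquiv u (p ++ q) := by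
  classical
  obtain ⟨p, q, rfl, hp⟩ := List.eq_append_cons_of_mem (h.perm.subset List.mem_cons_self)
  have hc : ∀ b ∈ p, ¬ A.Conflict a b := by
    intro b hb hab
    obtain ⟨k, hk⟩ := exists_occursAt_one hb
    have hl : OccursAt (p ++ a :: q) a 1 p.length :=
      occursAt_append.2 (Or.inr ⟨1, 0, by simp [List.count_eq_zero.2 hp], rfl,
        occursAt_cons.2 (Or.inl ⟨rfl, rfl, rfl⟩)⟩)
    obtain ⟨k', l', -, h2, h3⟩ := (h.symm A).2 b a 1 1 (Conflict.symm A hab)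
      ⟨k, _, occursAt_append.2 (Or.inl hk), hl, hk.lt⟩
    have := h2.unique (occursAt_cons.2 (Or.inl ⟨rfl, rfl, rfl⟩))
    omega
  exact ⟨p, q, rfl, hp, hc, SchedEquiv.of_cons (h.trans A (schedEquiv_move_front hp hc q))⟩

theorem proj_eq_nil_of_no_conflict {a c d : O} {p : List O} (hp : a ∉ p)
    (hc : ∀ b ∈ p, ¬ A.Conflict a b) (hcd : A.Dependent c d) (ha : a = c ∨ a = d) :
    proj c d p = [] := by
  rw [proj_eq_nil]
  rcases ha with rfl | rfl
  · refine ⟨hp, fun hd => ?_⟩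
    rcases hcd with rfl | h
    · exact hp hd
    · exact hc _ hd h
  · refine ⟨fun hd => ?_, hp⟩
    rcases hcd with rfl | h
    · exact hp hd
    · exact hc _ hd (Conflict.symm A h)

/-- If `a` is `c` or `d`, then `p` contains neither of them; otherwise the projection does not see
`a`. -/
theorem proj_move_front {a c d : O} {p : List O} (hp : a ∉ p)
    (hc : ∀ b ∈ p, ¬ A.Conflict a b) (hcd : A.Dependent c d) (q : List O) :
    proj c d (p ++ a :: q) = proj c d (a :: (p ++ q)) := by
  by_cases ha : a = c ∨ a = d
  · rw [proj_cons c d a (p ++ q), proj_append, proj_append, proj_cons c d a q,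
      proj_eq_nil_of_no_conflict hp hc hcd ha]
    simp
  · push Not at ha
    rw [proj_append, proj_cons_of_ne ha.1 ha.2, proj_cons_of_ne ha.1 ha.2, proj_append]

theorem SchedEquiv.proj_eq {s s' : List O} (h : A.SchedEquiv s s') {a b : O}
    (hab : A.Dependent a b) : proj a b s = proj a b s' := by
  induction s generalizing s' with
  | nil =>
    rw [h.perm.nil_eq]
  | cons c u ih =>
    obtain ⟨p, q, rfl, hp, hc, hu⟩ := h.exists_of_cons
    rw [proj_move_front hp hc hab, proj_cons, proj_cons a b c (p ++ q), ih hu]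

/-- If `a` comes first in the projections of `x`, then it can be moved to the front of `x`. -/
theorem exists_schedEquiv_cons {a : O} {x : List O}
    (h : ∀ b, A.Dependent a b → [a] <+: proj a b x) : ∃ x', A.SchedEquiv x (a :: x') := by
  have ha : a ∈ x := mem_proj_left.1 ((h a (Or.inl rfl)).subset (List.mem_singleton_self a))
  obtain ⟨p, q, rfl, hp⟩ := List.eq_append_cons_of_mem ha
  refine ⟨p ++ q, schedEquiv_move_front hp ?_ q⟩
  intro b hb hab
  have h1 := h b (Or.inr hab)
  rw [proj_append] at h1
  have h2 : proj a b p ≠ [] := fun h2 => (proj_eq_nil.1 h2).2 hb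
  obtain ⟨c, l, hl⟩ := List.exists_cons_of_ne_nil h2
  rw [hl] at h1
  obtain rfl : a = c := by simpa using h1
  exact hp (mem_proj_left.1 (hl ▸ List.mem_cons_self))

/-- For the converse, `u` is peeled off from the left: its head comes first in each relevant
projection of `x`, hence moves to the front of `x` and can be cancelled. The prefix order thereby
reduces to prefixes of lists. -/
theorem schedEquiv_append_iff_proj {u x : List O} :
    (∃ z, A.SchedEquiv x (u ++ z)) ↔ ∀ a b, A.Dependent a b → proj a b u <+: proj a b x := by
  constructor
  · rintro ⟨z, hz⟩ a b hab
    rw [hz.proj_eq hab, proj_append]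
    exact List.prefix_append _ _
  · intro h
    induction u generalizing x with
    | nil => exact ⟨x, SchedEquiv.refl A x⟩
    | cons a u ih =>
      obtain ⟨x', hx'⟩ : ∃ x', A.SchedEquiv x (a :: x') := by
        refine exists_schedEquiv_cons fun b hab => List.IsPrefix.trans ?_ (h a b hab)
        rw [proj_cons_left]
        exact ⟨_, rfl⟩
      obtain ⟨z, hz⟩ := ih (x := x') fun c d hcd => by
        have h1 := h c d hcd
        rw [hx'.proj_eq hcd, proj_cons, proj_cons c d a x'] at h1
        exact (List.prefix_append_right_inj _).1 h1
      exact ⟨z, hx'.trans A (hz.cons a)⟩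

/-! ### The prefix order of traces: cancellation, joins and meets -/

namespace Trace

theorem traceOf_eq_iff {s s' : List O} : A.traceOf s = A.traceOf s' ↔ A.SchedEquiv s s' :=
  ⟨fun h => Quotient.exact (s := A.schedSetoid) h, fun h => Quotient.sound (s := A.schedSetoid) h⟩

theorem exists_traceOf (t : A.Trace) : ∃ s, A.traceOf s = t := Quotient.exists_rep t

theorem ops_traceOf (s : List O) : (A.traceOf s).ops = (s : Multiset O) := rfl

theorem ops_one : (1 : A.Trace).ops = 0 := rfl

theorem le_mul_right (x y : A.Trace) : x ≤ x * y := ⟨y, rfl⟩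

theorem ops_le {x y : A.Trace} (h : x ≤ y) : x.ops ≤ y.ops := by
  obtain ⟨z, rfl⟩ := h
  rw [ops_mul]
  exact Multiset.le_add_right _ _

theorem one_le (x : A.Trace) : 1 ≤ x := ⟨x, (one_mul x).symm⟩

theorem traceOf_le_iff {u x : List O} : A.traceOf u ≤ A.traceOf x ↔
    ∀ a b, A.Dependent a b → proj a b u <+: proj a b x := by
  rw [← schedEquiv_append_iff_proj]
  constructor
  · rintro ⟨z, hz⟩
    obtain ⟨z, rfl⟩ := exists_traceOf z
    exact ⟨z, traceOf_eq_iff.1 hz⟩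
  · rintro ⟨z, hz⟩
    exact ⟨A.traceOf z, traceOf_eq_iff.2 hz⟩

theorem exists_cons_of_le {a : O} {u x : List O} (h : A.traceOf (a :: u) ≤ A.traceOf x) :
    ∃ x', A.traceOf x = A.traceOf (a :: x') := by
  obtain ⟨z, hz⟩ := h
  obtain ⟨z, rfl⟩ := exists_traceOf z
  exact ⟨u ++ z, hz⟩

theorem cons_le_cons {a : O} {u x : List O} :
    A.traceOf (a :: u) ≤ A.traceOf (a :: x) ↔ A.traceOf u ≤ A.traceOf x := by
  simp only [traceOf_le_iff, proj_cons _ _ a u, proj_cons _ _ a x, List.prefix_append_right_inj]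

/-- A prefix `v` of `a · x` either begins with `a` or is a prefix of `x`. -/
theorem le_cons_of_not_mem {a : O} {v x : List O} (hv : a ∉ v)
    (h : A.traceOf v ≤ A.traceOf (a :: x)) :
    A.traceOf v ≤ A.traceOf x ∧ A.traceOf v ≤ A.traceOf (a :: v) := by
  rw [traceOf_le_iff] at h
  have hnil : ∀ b, A.Dependent a b → proj a b v = [] := by
    intro b hab
    have h1 := h a b hab
    rw [proj_cons_left] at h1
    rcases hl : proj a b v with _ | ⟨c, l⟩
    · rfl
    · rw [hl] at h1
      obtain rfl : c = a := by simpa using (List.cons_prefix_cons.1 h1).1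
      exact absurd (mem_proj_left.1 (hl ▸ List.mem_cons_self)) hv
  simp only [traceOf_le_iff]
  rw [← forall_and]
  intro c
  rw [← forall_and]
  intro d
  rw [← forall_and]
  intro hcd
  by_cases ha : a = c ∨ a = d
  · have : proj c d v = [] := by
      rcases ha with rfl | rfl
      · exact hnil _ hcd
      · rw [proj_comm]
        exact hnil _ hcd.symm
    rw [this]
    exact ⟨List.nil_prefix, List.nil_prefix⟩
  · push Not at ha
    have h1 := h c d hcd
    rw [proj_cons_of_ne ha.1 ha.2] at h1 ⊢
    exact ⟨h1, List.prefix_rfl⟩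

/-- Each projection of `v` on `a` and a dependent operation is nonempty and a prefix of a list that
begins with `a`. -/
theorem exists_cons_of_mem {a : O} {v x : List O} (hv : a ∈ v)
    (h : A.traceOf v ≤ A.traceOf (a :: x)) : ∃ v', A.traceOf v = A.traceOf (a :: v') := by
  rw [traceOf_le_iff] at h
  obtain ⟨v', hv'⟩ : ∃ v', A.SchedEquiv v (a :: v') := by
    refine exists_schedEquiv_cons fun b hab => ?_
    have h1 := h a b hab
    rw [proj_cons_left] at h1
    rcases hl : proj a b v with _ | ⟨c, l⟩
    · exact absurd hv (proj_eq_nil.1 hl).1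
    · rw [hl] at h1
      obtain rfl : c = a := by simpa using (List.cons_prefix_cons.1 h1).1
      exact ⟨l, rfl⟩
  exact ⟨v', traceOf_eq_iff.2 hv'⟩

/-- Compatible traces have a least upper bound. -/
theorem exists_isLUB_pair {u v x : A.Trace} (hu : u ≤ x) (hv : v ≤ x) :
    ∃ w, IsLUB {u, v} w := by
  obtain ⟨u, rfl⟩ := exists_traceOf u
  induction u generalizing v x with
  | nil =>
    refine ⟨v, ?_, fun y hy => hy (by simp)⟩
    rintro y (rfl | rfl)
    · exact one_le _
    · exact le_rfl
  | cons a u ih =>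
    obtain ⟨x, rfl⟩ := exists_traceOf x
    obtain ⟨x', hx'⟩ := exists_cons_of_le hu
    rw [hx'] at hu hv
    obtain ⟨v, rfl⟩ := exists_traceOf v
    by_cases ha : a ∈ v
    · obtain ⟨v', hv'⟩ := exists_cons_of_mem ha hv
      rw [hv'] at hv ⊢
      obtain ⟨w, hw⟩ := ih (cons_le_cons.1 hv) (cons_le_cons.1 hu)
      obtain ⟨w, rfl⟩ := exists_traceOf w
      refine ⟨A.traceOf (a :: w), ?_, ?_⟩
      · rintro y (rfl | rfl)
        · exact cons_le_cons.2 (hw.1 (by simp))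
        · exact cons_le_cons.2 (hw.1 (by simp))
      · intro y hy
        obtain ⟨y, rfl⟩ := exists_traceOf y
        have h1 := hy (show A.traceOf (a :: u) ∈ _ by simp)
        have h2 := hy (show A.traceOf (a :: v') ∈ _ by simp)
        obtain ⟨y', hy'⟩ := exists_cons_of_le h1
        rw [hy'] at h1 h2 ⊢
        refine cons_le_cons.2 (hw.2 ?_)
        rintro z (rfl | rfl)
        · exact cons_le_cons.1 h1
        · exact cons_le_cons.1 h2
    -- Nothing in `v` depends on `a`, so `v` is also below `a · v`, and the join of `a · u` and `v`
    -- is `a` followed by the join of `u` and `v`.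
    · obtain ⟨hv₁, hv₂⟩ := le_cons_of_not_mem ha hv
      obtain ⟨w, hw⟩ := ih hv₁ (cons_le_cons.1 hu)
      obtain ⟨w, rfl⟩ := exists_traceOf w
      refine ⟨A.traceOf (a :: w), ?_, ?_⟩
      · rintro y (rfl | rfl)
        · exact cons_le_cons.2 (hw.1 (by simp))
        · exact hv₂.trans (cons_le_cons.2 (hw.1 (by simp)))
      · intro y hy
        obtain ⟨y, rfl⟩ := exists_traceOf y
        have h1 := hy (show A.traceOf (a :: u) ∈ _ by simp)
        have h2 := hy (show A.traceOf v ∈ _ by simp)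
        obtain ⟨y', hy'⟩ := exists_cons_of_le h1
        rw [hy'] at h1 h2 ⊢
        refine cons_le_cons.2 (hw.2 ?_)
        rintro z (rfl | rfl)
        · exact cons_le_cons.1 h1
        · exact (le_cons_of_not_mem ha h2).1

theorem eq_of_le_of_card_le {x y : A.Trace} (h : x ≤ y) (hc : y.ops.card ≤ x.ops.card) :
    x = y := by
  obtain ⟨z, rfl⟩ := h
  rw [ops_mul, Multiset.card_add] at hc
  rw [eq_one_of_ops_eq_zero (Multiset.card_eq_zero.1 (by omega : z.ops.card = 0)), mul_one]

/-- Every nonempty set of traces has a greatest lower bound. -/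
theorem exists_isGLB {X : Set A.Trace} (hX : X.Nonempty) : ∃ e, IsGLB X e := by
  obtain ⟨x, hx⟩ := hX
  let P : ℕ → Prop := fun m => ∃ e ∈ lowerBounds X, e.ops.card = m
  have hP : ∃ m, P m := ⟨_, 1, fun y _ => one_le y, rfl⟩
  have hb : ∀ m, P m → m ≤ x.ops.card := by
    rintro m ⟨e, he, rfl⟩
    exact Multiset.card_le_card (ops_le (he hx))
  classical
  obtain ⟨m₀, hm₀⟩ := hP
  -- A lower bound with the most operations; lower bounds are prefixes of `x`, so their sizes are
  -- bounded.
  obtain ⟨e, he, hcard⟩ := Nat.findGreatest_spec (hb m₀ hm₀) hm₀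
  refine ⟨e, he, fun u hu => ?_⟩
  -- The join of `u` and `e` exists below `x` and is again a lower bound, so by maximality it equals
  -- `e`.
  obtain ⟨w, hw⟩ := exists_isLUB_pair (hu hx) (he hx)
  have hw' : w ∈ lowerBounds X := by
    intro y hy
    refine hw.2 ?_
    rintro z (rfl | rfl)
    · exact hu hy
    · exact he hy
  have hle : w.ops.card ≤ e.ops.card := by
    rw [hcard]
    exact Nat.le_findGreatest (hb _ ⟨w, hw', rfl⟩) ⟨w, hw', rfl⟩
  have : e = w := eq_of_le_of_card_le (hw.1 (by simp)) hle
  rw [this]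
  exact hw.1 (by simp)

end Trace

/-! ### Responses -/

/-- The response to the `i`-th occurrence of `o` in `s`, executed from the state `q`, is `ρ`. -/
def RetFrom (A : SeqObject Q O R) (q : Q) (s : List O) (o : O) (i : ℕ) (ρ : R) : Prop :=
  ∃ k q', OccursAt s o i k ∧ (A.run s q)[k]? = some (ρ, q')

open Classical in
theorem retFrom_cons {q : Q} {a o : O} {u : List O} {i : ℕ} {ρ : R} :
    A.RetFrom q (a :: u) o i ρ ↔ (o = a ∧ i = 1 ∧ (A.step a q).1 = ρ) ∨
      ∃ i', i = [a].count o + i' ∧ A.RetFrom (A.step a q).2 u o i' ρ := by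
  constructor
  · rintro ⟨k, q', hk, hr⟩
    rcases occursAt_cons.1 hk with ⟨rfl, rfl, rfl⟩ | ⟨i', k', rfl, rfl, hk'⟩
    · refine Or.inl ⟨rfl, rfl, ?_⟩
      simp only [run, List.getElem?_cons_zero, Option.some.injEq] at hr
      rw [hr]
    · exact Or.inr ⟨i', rfl, k', q', hk', by simpa [run] using hr⟩
  · rintro (⟨rfl, rfl, rfl⟩ | ⟨i', rfl, k', q', hk', hr⟩)
    · exact ⟨0, (A.step o q).2, occursAt_cons.2 (Or.inl ⟨rfl, rfl, rfl⟩), by simp [run]⟩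
    · exact ⟨k' + 1, q', occursAt_cons.2 (Or.inr ⟨i', k', rfl, rfl, hk'⟩), by simpa [run] using hr⟩

theorem RetFrom.cons_mono {q : Q} {a o : O} {u u' : List O} {i : ℕ} {ρ : R}
    (h : ∀ q i, A.RetFrom q u o i ρ → A.RetFrom q u' o i ρ) (hu : A.RetFrom q (a :: u) o i ρ) :
    A.RetFrom q (a :: u') o i ρ := by
  rw [retFrom_cons] at hu ⊢
  exact hu.imp id fun ⟨i', h1, h2⟩ => ⟨i', h1, h _ _ h2⟩

/-- Commuting in the state `q` gives both operations the same responses and leads to the same state;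
as `a ≠ b`, the swap keeps all occurrence numbers. -/
theorem RetFrom.swap {q : Q} {a b o : O} {u : List O} {i : ℕ} {ρ : R} (hne : a ≠ b)
    (hab : ¬ A.Conflict a b) (h : A.RetFrom q (a :: b :: u) o i ρ) :
    A.RetFrom q (b :: a :: u) o i ρ := by
  classical
  have hcomm : A.CommuteIn q a b := by
    by_contra hq
    exact hab ⟨q, hq⟩
  obtain ⟨ra, rb, q₁, q₂, q', h1, h2, h3, h4⟩ := hcomm
  simp only [retFrom_cons, h1, h2, h3, h4] at h ⊢
  rcases h with ⟨rfl, rfl, rfl⟩ | ⟨i', rfl, ⟨rfl, rfl, rfl⟩ | ⟨i'', rfl, h⟩⟩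
  · exact Or.inr ⟨1, by simp [hne.symm], Or.inl ⟨rfl, rfl, rfl⟩⟩
  · exact Or.inl ⟨rfl, by simp [hne], rfl⟩
  · exact Or.inr ⟨[a].count o + i'', by omega, Or.inr ⟨i'', rfl, h⟩⟩

theorem RetFrom.move_back {q : Q} {a o : O} {p r : List O} {i : ℕ} {ρ : R} (hp : a ∉ p)
    (hc : ∀ b ∈ p, ¬ A.Conflict a b) (h : A.RetFrom q (a :: (p ++ r)) o i ρ) :
    A.RetFrom q (p ++ a :: r) o i ρ := by
  induction p generalizing q i with
  | nil => exact h
  | cons b p ih =>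
    rw [List.mem_cons, not_or] at hp
    have h1 := RetFrom.swap hp.1 (hc b List.mem_cons_self) h
    exact RetFrom.cons_mono
      (fun q i => ih hp.2 fun c hcp => hc c (List.mem_cons_of_mem b hcp)) h1

/-- Induction on `s`: the tail is replaced by the equivalent `p ++ r`, then the head `a` moves back
over `p` by swaps of operations that do not conflict. -/
theorem SchedEquiv.retFrom {s s' : List O} (hs : A.SchedEquiv s s') {q : Q} {o : O} {i : ℕ} {ρ : R}
    (h : A.RetFrom q s o i ρ) : A.RetFrom q s' o i ρ := by
  induction s generalizing s' q i with
  | nil =>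
    rw [← hs.perm.nil_eq]
    exact h
  | cons a u ih =>
    obtain ⟨p, r, rfl, hp, hc, hu⟩ := hs.exists_of_cons
    exact RetFrom.move_back hp hc (RetFrom.cons_mono (fun q i => ih hu) h)

/-- The response does not depend on the representative. -/
theorem RetTrace.retSched {s : List O} {o : O} {i : ℕ} {ρ : R}
    (h : A.RetTrace (A.traceOf s) o i ρ) : A.RetSched s o i ρ := by
  obtain ⟨s', hs', h⟩ := h
  exact SchedEquiv.retFrom (Trace.traceOf_eq_iff.1 hs') h

theorem run_prefix (x y : List O) (q : Q) : A.run x q <+: A.run (x ++ y) q := by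
  induction x generalizing q with
  | nil => exact List.nil_prefix
  | cons a x ih => exact List.cons_prefix_cons.2 ⟨rfl, ih _⟩

theorem RetSched.of_prefix {s s' : List O} (hs : s <+: s') {o : O} {i : ℕ} {ρ : R}
    (h : A.RetSched s o i ρ) : A.RetSched s' o i ρ := by
  obtain ⟨z, rfl⟩ := hs
  obtain ⟨k, q, hk, hr⟩ := h
  refine ⟨k, q, occursAt_append.2 (Or.inl hk), ?_⟩
  obtain ⟨w, hw⟩ := run_prefix (A := A) s z A.init
  rw [← hw, List.getElem?_append_left (List.getElem?_eq_some_iff.1 hr).1, hr]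

/-- The states are given by one function on all times, so that the same `q` serves every schedule of
a chain. -/
theorem run_getElem? {s : List O} {q : ℕ → Q}
    (hq : ∀ p c, s[p]? = some c → q (p + 1) = (A.step c (q p)).2) {p : ℕ} {c : O}
    (hp : s[p]? = some c) : (A.run s (q 0))[p]? = some (A.step c (q p)) := by
  induction s generalizing q p with
  | nil => simp at hp
  | cons a s ih =>
    rcases p with _ | p
    · obtain rfl : a = c := by simpa using hp
      simp [run]
    · have h0 := hq 0 a (by simp)
      have := ih (q := fun m => q (m + 1)) (fun m c hm => hq (m + 1) c (by simpa using hm))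
        (p := p) (by simpa using hp)
      simp only [run, List.getElem?_cons_succ]
      rw [← h0]
      exact this

end SeqObject

/-! ### The monotone part of the specification of generalized commit-adopt -/

namespace GCAState

variable {Q O R : Type*} {A : SeqObject Q O R} {n : ℕ}

open Classical in
/-- The consequences of the specification that are not affected by further inputs. -/
structure SafetySpec (g : GCAState n A.Trace) : Prop where
  validity : ∀ j t c, g.out j = some (t, c) →
    ∀ o, ∃ i x, g.inp i = some x ∧ t.ops.count o ≤ x.ops.count o
  adoption : ∀ i j t t' c, g.out i = some (t, true) → g.out j = some (t', c) → t ≤ t'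
  lower : ∀ u, (∀ i x, g.inp i = some x → u ≤ x) → ∀ j t c, g.out j = some (t, c) → u ≤ t

/-- Some input must exist for the inputs to have a greatest lower bound; any other lower bound is
below it. -/
theorem Spec.safetySpec {g : GCAState n A.Trace} (h : g.Spec) (hg : ∃ i, (g.inp i).isSome) :
    g.SafetySpec where
  validity j t c hj o := by
    obtain ⟨x, ⟨i, hi⟩, hx⟩ := h.validity j t c hj o
    exact ⟨i, x, hi, hx⟩
  adoption i j t t' c hi hj := h.adoption i t hi t' ⟨j, c, hj⟩
  lower u hu j t c hj := by
    obtain ⟨i, hi⟩ := hg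
    obtain ⟨x, hx⟩ := Option.isSome_iff_exists.1 hi
    obtain ⟨e, he⟩ := SeqObject.Trace.exists_isGLB (X := g.inputs) ⟨x, i, hx⟩
    refine le_trans (he.2 ?_) (h.commonPrefix e he t ⟨j, c, hj⟩)
    rintro y ⟨i', hi'⟩
    exact hu i' y hi'

/-- More inputs give more witnesses for `validity` and fewer lower bounds `u` to consider in
`lower`. -/
theorem SafetySpec.mono {g g' : GCAState n A.Trace} (h : g.SafetySpec) (hout : g'.out = g.out)
    (hinp : ∀ i x, g.inp i = some x → g'.inp i = some x) : g'.SafetySpec where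
  validity j t c hj o := by
    rw [hout] at hj
    obtain ⟨i, x, hi, hx⟩ := h.validity j t c hj o
    exact ⟨i, x, hinp i x hi, hx⟩
  adoption i j t t' c hi hj := by
    rw [hout] at hi hj
    exact h.adoption i j t t' c hi hj
  lower u hu j t c hj := by
    rw [hout] at hj
    exact h.lower u (fun i x hi => hu i x (hinp i x hi)) j t c hj

theorem SafetySpec.exists_mem {g : GCAState n A.Trace} (h : g.SafetySpec) {j : Fin n}
    {t : A.Trace} {c : Bool} (hj : g.out j = some (t, c)) {o : O} (ho : o ∈ t.ops) :
    ∃ i x, g.inp i = some x ∧ o ∈ x.ops := by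
  classical
  obtain ⟨i, x, hi, hx⟩ := h.validity j t c hj o
  exact ⟨i, x, hi, Multiset.count_pos.1 ((Multiset.count_pos.2 ho).trans_le hx)⟩

end GCAState

section Algorithm

variable {Q O R : Type*} {A : SeqObject Q O R} {n : ℕ}

/-! ### Effects of a step -/

/-- The command being executed. -/
def Loc.pending : Loc A n → Option (Cmd n O)
  | .idle => none
  | .collect cmd _ => some cmd
  | .loop cmd _ _ _ => some cmd
  | .inGCA cmd _ => some cmd
  | .done cmd _ => some cmd

/-- The round reached in the code, if the last round written is `r₀`. -/
def Loc.round : Loc A n → ℕ → ℕ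
  | .loop _ r _ _, _ => r
  | .inGCA _ r, _ => r
  | _, r₀ => r₀

/-- The last round of a process. -/
def Config.round (C : Config A n) (i : Fin n) : ℕ := (C.loc i).round (C.S i).1

open Classical in
/-- The trace proposed after `s` by a process that executes `cmd`. -/
noncomputable def proposal (s : CTrace A n) (cmd : Cmd n O) : CTrace A n :=
  if cmd ∉ s.ops then s * (A.cmdObject n).traceOf [cmd] else s

theorem le_proposal (s : CTrace A n) (cmd : Cmd n O) : s ≤ proposal s cmd := by
  unfold proposal
  split_ifs
  · exact le_rfl
  · exact SeqObject.Trace.le_mul_right _ _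

theorem mem_proposal {s : CTrace A n} {cmd o : Cmd n O} :
    o ∈ (proposal s cmd).ops ↔ o ∈ s.ops ∨ o = cmd := by
  unfold proposal
  split_ifs with h
  · exact ⟨Or.inl, fun h' => h'.elim id fun h' => h' ▸ h⟩
  · rw [SeqObject.Trace.ops_mul, Multiset.mem_add, SeqObject.Trace.ops_traceOf]
    simp

theorem nodup_proposal {s : CTrace A n} (cmd : Cmd n O) (hs : s.ops.Nodup) :
    (proposal s cmd).ops.Nodup := by
  unfold proposal
  split_ifs with h
  · exact hs
  · rw [SeqObject.Trace.ops_mul, SeqObject.Trace.ops_traceOf, add_comm]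
    exact Multiset.nodup_cons.2 ⟨h, hs⟩

open Classical in
theorem update_gca_inp {T : Type*} (f : ℕ → GCAState n T) (ρ r : ℕ) (i j : Fin n) (v : Option T) :
    (Function.update f ρ { f ρ with inp := Function.update (f ρ).inp i v } r).inp j =
      if r = ρ ∧ j = i then v else (f r).inp j := by
  rcases eq_or_ne r ρ with rfl | hr
  · rcases eq_or_ne j i with rfl | hj
    · simp
    · simp [hj]
  · simp [hr]

open Classical in
theorem update_gca_out {T : Type*} (f : ℕ → GCAState n T) (ρ r : ℕ) (i j : Fin n)
    (v : Option (T × Bool)) :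
    (Function.update f ρ { f ρ with out := Function.update (f ρ).out i v } r).out j =
      if r = ρ ∧ j = i then v else (f r).out j := by
  rcases eq_or_ne r ρ with rfl | hr
  · rcases eq_or_ne j i with rfl | hj
    · simp
    · simp [hj]
  · simp [hr]

theorem update_gca_inp_out {T : Type*} (f : ℕ → GCAState n T) (ρ r : ℕ) (w : Fin n → Option T) :
    (Function.update f ρ { f ρ with inp := w } r).out = (f r).out := by
  rcases eq_or_ne r ρ with rfl | hr
  · simp
  · simp [hr]

theorem update_gca_out_inp {T : Type*} (f : ℕ → GCAState n T) (ρ r : ℕ)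
    (w : Fin n → Option (T × Bool)) :
    (Function.update f ρ { f ρ with out := w } r).inp = (f r).inp := by
  rcases eq_or_ne r ρ with rfl | hr
  · simp
  · simp [hr]

variable {C C' : Config A n} {l : Label A n}

/-- An input after a step was there before, or is proposed in this step. -/
theorem Step.inp_cases (h : Step C l C') {r : ℕ} {i : Fin n} {x : CTrace A n}
    (hx : (C'.gca r).inp i = some x) : (C.gca r).inp i = some x ∨
      ∃ cmd r' s c, r = r' + 1 ∧ C.loc i = .loop cmd r' s c ∧ x = proposal s cmd := by
  cases h with
  | propose i₀ cmd r' s c hloc hc =>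
    dsimp only at hx
    rw [update_gca_inp] at hx
    by_cases hr : r = r' + 1 ∧ i = i₀
    · rw [if_pos hr] at hx
      obtain ⟨rfl, rfl⟩ := hr
      exact Or.inr ⟨cmd, r', s, c, rfl, hloc, (Option.some.inj hx).symm⟩
    · rw [if_neg hr] at hx
      exact Or.inl hx
  | gcaReturn i₀ cmd r₀ t c g hloc hg hspec =>
    subst hg
    dsimp only at hx
    rw [update_gca_out_inp] at hx
    exact Or.inl hx
  | _ => exact Or.inl hx

/-- An output after a step was there before, or is returned in this step. -/
theorem Step.out_cases (h : Step C l C') {r : ℕ} {i : Fin n} {t : CTrace A n} {c : Bool}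
    (hx : (C'.gca r).out i = some (t, c)) : (C.gca r).out i = some (t, c) ∨
      l = .gcaReturn i r t c ∧ ∃ cmd, C.loc i = .inGCA cmd r := by
  cases h with
  | propose i₀ cmd r' s c hloc hc =>
    dsimp only at hx
    rw [update_gca_inp_out] at hx
    exact Or.inl hx
  | gcaReturn i₀ cmd r₀ t c g hloc hg hspec =>
    subst hg
    dsimp only at hx
    rw [update_gca_out] at hx
    split_ifs at hx with hr
    · obtain ⟨rfl, rfl⟩ := hr
      simp only [Option.some.injEq, Prod.mk.injEq] at hx
      obtain ⟨rfl, rfl⟩ := hx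
      exact Or.inr ⟨rfl, cmd, hloc⟩
    · exact Or.inl hx
  | _ => exact Or.inl hx

theorem Step.out_of_gcaReturn {i : Fin n} {r : ℕ} {t : CTrace A n} {c : Bool}
    (h : Step C (.gcaReturn i r t c) C') : (C'.gca r).out i = some (t, c) := by
  cases h with
  | gcaReturn i₀ cmd r₀ t c g hloc hg hspec =>
    subst hg
    dsimp only
    rw [update_gca_out, if_pos ⟨rfl, rfl⟩]

theorem Step.pending (h : Step C l C') {i : Fin n} {cmd : Cmd n O}
    (hi : (C.loc i).pending = some cmd) (hl : ∀ e, l.event = some e → e.proc ≠ i) :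
    (C'.loc i).pending = some cmd := by
  cases h with
  | idle => exact hi
  | invoke i₀ op h =>
    have : i ≠ i₀ := (hl _ rfl).symm
    simpa [this] using hi
  | respond i₀ cmd s ρ h hρ =>
    have : i ≠ i₀ := (hl _ rfl).symm
    simpa [this] using hi
  | read i₀ _ _ _ h _ | select i₀ _ _ _ h _ | propose i₀ _ _ _ _ h _
  | gcaReturn i₀ _ _ _ _ _ h _ _ | write i₀ _ _ _ _ h _ =>
    rcases eq_or_ne i i₀ with rfl | hne
    · rw [h] at hi
      simpa [Loc.pending] using hi
    · simpa [hne] using hi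

/-! ### Every process calls every GCA object at most once -/

/-- Process `i` has not accessed the rounds after its current one. -/
structure Config.OneShot (C : Config A n) (i : Fin n) : Prop where
  fresh : ∀ r, C.round i < r → (C.gca r).inp i = none ∧ (C.gca r).out i = none
  le : (C.S i).1 ≤ C.round i
  view : ∀ cmd view x, C.loc i = .collect cmd view → view i = some x → x.1 = (C.S i).1
  calling : ∀ cmd r, C.loc i = .inGCA cmd r → (C.gca r).out i = none ∧ ((C.gca r).inp i).isSome

theorem Config.oneShot_initial (i : Fin n) : (Config.initial A n).OneShot i where
  fresh r _ := ⟨rfl, rfl⟩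
  le := le_rfl
  view cmd view x h := by cases h
  calling cmd r h := by cases h

theorem Config.OneShot.congr (h : C.OneShot i) (hloc : C'.loc i = C.loc i) (hS : C'.S i = C.S i)
    (hinp : ∀ r, (C'.gca r).inp i = (C.gca r).inp i)
    (hout : ∀ r, (C'.gca r).out i = (C.gca r).out i) : C'.OneShot i := by
  have hr : C'.round i = C.round i := by simp only [Config.round, hloc, hS]
  constructor
  · intro r
    rw [hr, hinp, hout]
    exact h.fresh r
  · rw [hr, hS]
    exact h.le
  · rw [hloc, hS]
    exact h.view
  · intro cmd r
    rw [hinp, hout, hloc]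
    exact h.calling cmd r

/-- The round of a process never decreases, and a proposal goes to the next round, which the process
has not yet accessed. -/
theorem Step.oneShot (h : Step C l C') {i : Fin n} (hi : C.OneShot i) : C'.OneShot i := by
  cases h with
  | idle => exact hi
  | invoke i₀ op h =>
    rcases eq_or_ne i i₀ with rfl | hne
    · have hr : C.round i = (C.S i).1 := by simp [Config.round, h, Loc.round]
      constructor
      · have hfresh := hi.fresh
        rw [hr] at hfresh
        simpa [Config.round, Loc.round] using hfresh
      · simp [Config.round, Loc.round]
      · intro cmd view x h1 h2
        simp only [Function.update_self, Loc.collect.injEq] at h1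
        rw [← h1.2] at h2
        simp at h2
      · simp
    · exact hi.congr (by simp [hne]) rfl (fun _ => rfl) (fun _ => rfl)
  | read i₀ j cmd view h hj =>
    rcases eq_or_ne i i₀ with rfl | hne
    · have hr : C.round i = (C.S i).1 := by simp [Config.round, h, Loc.round]
      constructor
      · have hfresh := hi.fresh
        rw [hr] at hfresh
        simpa [Config.round, Loc.round] using hfresh
      · simp [Config.round, Loc.round]
      · intro cmd' view' x h1 h2
        simp only [Function.update_self, Loc.collect.injEq] at h1
        rw [← h1.2] at h2
        rcases eq_or_ne i j with rfl | hij
        · simp only [Function.update_self, Option.some.injEq] at h2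
          rw [← h2]
        · rw [Function.update_of_ne hij] at h2
          exact hi.view _ _ _ h h2
      · simp
    · exact hi.congr (by simp [hne]) rfl (fun _ => rfl) (fun _ => rfl)
  | select i₀ j cmd view h hmax =>
    rcases eq_or_ne i i₀ with rfl | hne
    · have hr : C.round i = (C.S i).1 := by simp [Config.round, h, Loc.round]
      -- A process also reads its own register, which only it writes, so the maximal round read is
      -- at least its own last one.
      have hle : (C.S i).1 ≤ (view j).1 := by
        rw [← hi.view _ _ _ h rfl]
        exact hmax i
      constructor
      · intro r hr'
        simp only [Config.round, Function.update_self, Loc.round] at hr'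
        exact hi.fresh r (by omega)
      · simpa [Config.round, Loc.round] using hle
      · simp
      · simp
    · exact hi.congr (by simp [hne]) rfl (fun _ => rfl) (fun _ => rfl)
  | propose i₀ cmd r s c h hc =>
    rcases eq_or_ne i i₀ with rfl | hne
    · have hr : C.round i = r := by simp [Config.round, h, Loc.round]
      constructor
      · intro r' hr'
        simp only [Config.round, Function.update_self, Loc.round] at hr'
        dsimp only
        rw [update_gca_inp, update_gca_inp_out, if_neg (by omega)]
        exact hi.fresh r' (by omega)
      · have := hi.le
        simp only [Config.round, Function.update_self, Loc.round]
        omega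
      · simp
      · intro cmd' r' h'
        simp only [Function.update_self, Loc.inGCA.injEq] at h'
        obtain ⟨-, rfl⟩ := h'
        dsimp only
        rw [update_gca_inp, update_gca_inp_out, if_pos ⟨rfl, rfl⟩]
        exact ⟨(hi.fresh _ (by omega)).2, rfl⟩
    · refine hi.congr (by simp [hne]) rfl (fun r' => ?_) (fun r' => ?_)
      · dsimp only
        rw [update_gca_inp, if_neg (by simp [hne])]
      · dsimp only
        rw [update_gca_inp_out]
  | gcaReturn i₀ cmd r t c g h hg hspec =>
    subst hg
    rcases eq_or_ne i i₀ with rfl | hne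
    · have hr : C.round i = r := by simp [Config.round, h, Loc.round]
      constructor
      · intro r' hr'
        simp only [Config.round, Function.update_self, Loc.round] at hr'
        dsimp only
        rw [update_gca_out, update_gca_out_inp, if_neg (by omega)]
        exact hi.fresh r' (by omega)
      · have := hi.le
        simp only [Config.round, Function.update_self, Loc.round]
        omega
      · simp
      · simp
    · refine hi.congr (by simp [hne]) rfl (fun r' => ?_) (fun r' => ?_)
      · dsimp only
        rw [update_gca_out_inp]
      · dsimp only
        rw [update_gca_out, if_neg (by simp [hne])]
  | write i₀ cmd r s c h hc =>
    rcases eq_or_ne i i₀ with rfl | hne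
    · have hr : C.round i = r := by simp [Config.round, h, Loc.round]
      constructor
      · have hfresh := hi.fresh
        rw [hr] at hfresh
        simpa [Config.round, Loc.round] using hfresh
      · simp [Config.round, Loc.round]
      · simp
      · simp
    · exact hi.congr (by simp [hne]) (by simp [hne]) (fun _ => rfl) (fun _ => rfl)
  | respond i₀ cmd s ρ h hρ =>
    rcases eq_or_ne i i₀ with rfl | hne
    · have hr : C.round i = (C.S i).1 := by simp [Config.round, h, Loc.round]
      constructor
      · have hfresh := hi.fresh
        rw [hr] at hfresh
        simpa [Config.round, Loc.round] using hfresh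
      · simp [Config.round, Loc.round]
      · simp
      · simp
    · exact hi.congr (by simp [hne]) rfl (fun _ => rfl) (fun _ => rfl)

/-- A proposal overwrites nothing, because the process is new to that round. -/
theorem Step.inp_mono (h : Step C l C') {i : Fin n} (hi : C.OneShot i) {r : ℕ} {x : CTrace A n}
    (hx : (C.gca r).inp i = some x) : (C'.gca r).inp i = some x := by
  cases h with
  | propose i₀ cmd r' s c hloc hc =>
    dsimp only
    rw [update_gca_inp]
    by_cases hr : r = r' + 1 ∧ i = i₀
    · obtain ⟨rfl, rfl⟩ := hr
      have := (hi.fresh (r' + 1) (by simp [Config.round, hloc, Loc.round])).1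
      rw [this] at hx
      cases hx
    · rw [if_neg hr]
      exact hx
  | gcaReturn i₀ cmd r₀ t c g hloc hg hspec =>
    subst hg
    dsimp only
    rw [update_gca_out_inp]
    exact hx
  | _ => exact hx

theorem Step.out_mono (h : Step C l C') {i : Fin n} (hi : C.OneShot i) {r : ℕ}
    {p : CTrace A n × Bool} (hx : (C.gca r).out i = some p) : (C'.gca r).out i = some p := by
  cases h with
  | propose i₀ cmd r' s c hloc hc =>
    dsimp only
    rw [update_gca_inp_out]
    exact hx
  | gcaReturn i₀ cmd r₀ t c g hloc hg hspec =>
    subst hg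
    dsimp only
    rw [update_gca_out]
    split_ifs with hr
    · obtain ⟨rfl, rfl⟩ := hr
      have := (hi.calling _ _ hloc).1
      rw [this] at hx
      cases hx
    · exact hx
  | _ => exact hx

theorem Step.round_S_mono (h : Step C l C') {i : Fin n} (hi : C.OneShot i) :
    (C.S i).1 ≤ (C'.S i).1 := by
  cases h with
  | write i₀ cmd r s c h hc =>
    rcases eq_or_ne i i₀ with rfl | hne
    · have := hi.le
      simpa [Config.round, h, Loc.round] using this
    · simp [hne]
  | _ => exact le_rfl

/-- The full specification is available only at the moment a call returns. Later proposals to the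
same object only add inputs, which the safety part tolerates. -/
theorem Step.safetySpec (h : Step C l C') (hC : ∀ i, C.OneShot i)
    (hs : ∀ r, (C.gca r).SafetySpec) (r : ℕ) : (C'.gca r).SafetySpec := by
  have hmono := fun i x => h.inp_mono (hC i) (r := r) (x := x)
  cases h with
  | propose i₀ cmd r' s c hloc hc =>
    exact (hs r).mono (update_gca_inp_out _ _ _ _) hmono
  | gcaReturn i₀ cmd r₀ t c g hloc hg hspec =>
    dsimp only at hmono ⊢
    rcases eq_or_ne r r₀ with rfl | hr
    · rw [Function.update_self]
      refine hspec.safetySpec ⟨i₀, ?_⟩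
      rw [hg]
      exact ((hC i₀).calling _ _ hloc).2
    · rw [Function.update_of_ne hr]
      exact hs r
  | _ => exact hs r

/-! ### Where traces come from -/

/-- The trace `s` is the initial value of round `0` or has been returned at round `r`. -/
def Config.Source (C : Config A n) (r : ℕ) (s : CTrace A n) : Prop :=
  (r = 0 ∧ s = 1) ∨ ∃ j c, (C.gca r).out j = some (s, c)

/-- The pair is an initial value or its trace is committed at its round. -/
def Config.Stored (C : Config A n) (x : ℕ × CTrace A n) : Prop :=
  x = (0, 1) ∨ ∃ j, (C.gca x.1).out j = some (x.2, true)

theorem Config.Stored.source {x : ℕ × CTrace A n} (h : C.Stored x) : C.Source x.1 x.2 := by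
  rcases h with rfl | ⟨j, hj⟩
  · exact Or.inl ⟨rfl, rfl⟩
  · exact Or.inr ⟨j, true, hj⟩

/-- The traces in a configuration are returned by GCA objects. -/
structure Config.Provenance (C : Config A n) : Prop where
  stored : ∀ j, C.Stored (C.S j)
  view : ∀ i j cmd view x, C.loc i = .collect cmd view → view j = some x → C.Stored x
  loop : ∀ i cmd r s c, C.loc i = .loop cmd r s c →
    C.Source r s ∧ (c = true → ∃ j, (C.gca r).out j = some (s, true))
  done : ∀ i cmd s, C.loc i = .done cmd s → (C.S i).2 = s ∧ cmd ∈ s.ops ∧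
    ∃ j, (C.gca (C.S i).1).out j = some (s, true)
  inp : ∀ r i x, (C.gca r).inp i = some x → ∃ r' s, r = r' + 1 ∧ C.Source r' s ∧ s ≤ x
  pos : ∀ r i p, (C.gca r).out i = some p → 0 < r

theorem Config.provenance_initial : (Config.initial A n).Provenance where
  stored _ := Or.inl rfl
  view _ _ _ _ _ h := by cases h
  loop _ _ _ _ _ h := by cases h
  done _ _ _ h := by cases h
  inp _ _ _ h := by cases h
  pos _ _ _ h := by cases h

theorem Step.provenance (h : Step C l C') (hC : ∀ i, C.OneShot i) (hp : C.Provenance) :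
    C'.Provenance := by
  -- Outputs are never erased, so all that is known in `C` carries over to `C'`; in each case below
  -- only the process that moves needs an argument.
  have hout : ∀ r j p, (C.gca r).out j = some p → (C'.gca r).out j = some p :=
    fun r j p => h.out_mono (hC j)
  have hsource : ∀ r s, C.Source r s → C'.Source r s :=
    fun r s => Or.imp id fun ⟨j, c, hj⟩ => ⟨j, c, hout _ _ _ hj⟩
  have hstored : ∀ x, C.Stored x → C'.Stored x :=
    fun x => Or.imp id fun ⟨j, hj⟩ => ⟨j, hout _ _ _ hj⟩
  have hview : ∀ i j cmd view x, C.loc i = .collect cmd view → view j = some x → C'.Stored x :=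
    fun i j cmd view x h1 h2 => hstored _ (hp.view i j cmd view x h1 h2)
  have hloop : ∀ i cmd r s c, C.loc i = .loop cmd r s c →
      C'.Source r s ∧ (c = true → ∃ j, (C'.gca r).out j = some (s, true)) := by
    intro i cmd r s c hi
    obtain ⟨h1, h2⟩ := hp.loop i cmd r s c hi
    exact ⟨hsource _ _ h1, fun hc => (h2 hc).imp fun j hj => hout _ _ _ hj⟩
  have hdone : ∀ i cmd s, C.loc i = .done cmd s → (C.S i).2 = s ∧ cmd ∈ s.ops ∧
      ∃ j, (C'.gca (C.S i).1).out j = some (s, true) := by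
    intro i cmd s hi
    obtain ⟨h1, h2, h3⟩ := hp.done i cmd s hi
    exact ⟨h1, h2, h3.imp fun j hj => hout _ _ _ hj⟩
  have hinp : ∀ r i x, (C'.gca r).inp i = some x →
      ∃ r' s, r = r' + 1 ∧ C'.Source r' s ∧ s ≤ x := by
    intro r i x hx
    rcases h.inp_cases hx with hx | ⟨cmd, r', s, c, rfl, hi, rfl⟩
    · obtain ⟨r', s, h1, h2, h3⟩ := hp.inp r i x hx
      exact ⟨r', s, h1, hsource _ _ h2, h3⟩
    · exact ⟨r', s, rfl, (hloop _ _ _ _ _ hi).1, le_proposal s cmd⟩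
  have hpos : ∀ r i p, (C'.gca r).out i = some p → 0 < r := by
    rintro r i ⟨t, c⟩ hx
    rcases h.out_cases hx with hx | ⟨-, cmd, hi⟩
    · exact hp.pos r i _ hx
    · obtain ⟨x, hx⟩ := Option.isSome_iff_exists.1 ((hC i).calling _ _ hi).2
      obtain ⟨r', -, rfl, -⟩ := hp.inp _ _ _ hx
      omega
  have hret := fun i r t c => show l = .gcaReturn i r t c → (C'.gca r).out i = some (t, c) from
    fun hl => Step.out_of_gcaReturn (C := C) (hl ▸ h)
  have hS : ∀ j, C'.Stored (C.S j) := fun j => hstored _ (hp.stored j)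
  cases h with
  | idle => exact hp
  | invoke i₀ op h =>
    refine ⟨hS, ?_, ?_, ?_, hinp, hpos⟩ <;> intro i <;> rcases eq_or_ne i i₀ with rfl | hne
    · intro j cmd view x h1 h2
      simp only [Function.update_self, Loc.collect.injEq] at h1
      rw [← h1.2] at h2
      cases h2
    · simpa only [Function.update_of_ne hne] using hview i
    · simp
    · simpa only [Function.update_of_ne hne] using hloop i
    · simp
    · simpa only [Function.update_of_ne hne] using hdone i
  | read i₀ j₀ cmd view h hj =>
    refine ⟨hS, ?_, ?_, ?_, hinp, hpos⟩ <;> intro i <;> rcases eq_or_ne i i₀ with rfl | hne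
    · intro j cmd' view' x h1 h2
      simp only [Function.update_self, Loc.collect.injEq] at h1
      rw [← h1.2] at h2
      rcases eq_or_ne j j₀ with rfl | hij
      · simp only [Function.update_self, Option.some.injEq] at h2
        rw [← h2]
        exact hS j
      · rw [Function.update_of_ne hij] at h2
        exact hview _ _ _ _ _ h h2
    · simpa only [Function.update_of_ne hne] using hview i
    · simp
    · simpa only [Function.update_of_ne hne] using hloop i
    · simp
    · simpa only [Function.update_of_ne hne] using hdone i
  | select i₀ j₀ cmd view h hmax =>
    refine ⟨hS, ?_, ?_, ?_, hinp, hpos⟩ <;> intro i <;> rcases eq_or_ne i i₀ with rfl | hne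
    · simp
    · simpa only [Function.update_of_ne hne] using hview i
    · intro cmd' r s c h1
      simp only [Function.update_self, Loc.loop.injEq] at h1
      obtain ⟨-, rfl, rfl, rfl⟩ := h1
      exact ⟨(hview i j₀ _ _ _ h rfl).source, by simp⟩
    · simpa only [Function.update_of_ne hne] using hloop i
    · simp
    · simpa only [Function.update_of_ne hne] using hdone i
  | propose i₀ cmd r s c h hc =>
    refine ⟨hS, ?_, ?_, ?_, hinp, hpos⟩ <;> intro i <;> rcases eq_or_ne i i₀ with rfl | hne
    · simp
    · simpa only [Function.update_of_ne hne] using hview i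
    · simp
    · simpa only [Function.update_of_ne hne] using hloop i
    · simp
    · simpa only [Function.update_of_ne hne] using hdone i
  | gcaReturn i₀ cmd r t c g h hg hspec =>
    have hret := hret _ _ _ _ rfl
    refine ⟨hS, ?_, ?_, ?_, hinp, hpos⟩ <;> intro i <;> rcases eq_or_ne i i₀ with rfl | hne
    · simp
    · simpa only [Function.update_of_ne hne] using hview i
    · intro cmd' r' s' c' h1
      simp only [Function.update_self, Loc.loop.injEq] at h1
      obtain ⟨-, rfl, rfl, rfl⟩ := h1
      exact ⟨Or.inr ⟨i, c, hret⟩, fun hc => ⟨i, hc ▸ hret⟩⟩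
    · simpa only [Function.update_of_ne hne] using hloop i
    · simp
    · simpa only [Function.update_of_ne hne] using hdone i
  | write i₀ cmd r s c h hc =>
    -- The loop is left only with `c = true`, so the pair written is committed.
    simp only [not_or, not_not, Bool.not_eq_false] at hc
    have hcom := (hloop _ _ _ _ _ h).2 hc.2
    refine ⟨?_, ?_, ?_, ?_, hinp, hpos⟩ <;> intro i <;> rcases eq_or_ne i i₀ with rfl | hne
    · simp only [Function.update_self]
      exact Or.inr hcom
    · simpa only [Function.update_of_ne hne] using hS i
    · simp
    · simpa only [Function.update_of_ne hne] using hview i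
    · simp
    · simpa only [Function.update_of_ne hne] using hloop i
    · intro cmd' s' h1
      simp only [Function.update_self, Loc.done.injEq] at h1
      obtain ⟨rfl, rfl⟩ := h1
      simp only [Function.update_self]
      exact ⟨trivial, hc.1, hcom⟩
    · simpa only [Function.update_of_ne hne] using hdone i
  | respond i₀ cmd s ρ h hρ =>
    refine ⟨hS, ?_, ?_, ?_, hinp, hpos⟩ <;> intro i <;> rcases eq_or_ne i i₀ with rfl | hne
    · simp
    · simpa only [Function.update_of_ne hne] using hview i
    · simp
    · simpa only [Function.update_of_ne hne] using hloop i
    · simp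
    · simpa only [Function.update_of_ne hne] using hdone i

/-- A committed trace is a prefix of the traces returned at the same or later rounds. -/
theorem Config.le_of_committed (hs : ∀ r, (C.gca r).SafetySpec) (hp : C.Provenance) {r r' : ℕ}
    (hr : r ≤ r') {i j : Fin n} {t t' : CTrace A n} {c : Bool}
    (ht : (C.gca r).out i = some (t, true)) (ht' : (C.gca r').out j = some (t', c)) : t ≤ t' := by
  induction r', hr using Nat.le_induction generalizing j t' c with
  | base => exact (hs r).adoption i j t t' c ht ht'
  | succ r' hr ih =>
    -- It suffices that `t` is below every input of round `r' + 1`; such an input extends a source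
    -- of round `r'`.
    refine (hs (r' + 1)).lower t (fun i' x hx => ?_) j t' c ht'
    obtain ⟨r'', s, hr'', hsrc, hle⟩ := hp.inp _ _ _ hx
    obtain rfl : r' = r'' := by omega
    refine le_trans ?_ hle
    -- The initial trace is a source only of round `0`, where nothing is committed.
    rcases hsrc with ⟨rfl, -⟩ | ⟨j', c', hj'⟩
    · have := hp.pos _ _ _ ht
      omega
    · exact ih hj'

end Algorithm

section Algorithm

variable {Q O R : Type*} {A : SeqObject Q O R} {n : ℕ}

/-! ### Commands -/

variable {C C' : Config A n} {l : Label A n}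

theorem Step.seq_mono (h : Step C l C') (i : Fin n) : C.seq i ≤ C'.seq i := by
  cases h with
  | invoke i₀ op h =>
    rcases eq_or_ne i i₀ with rfl | hne
    · simp
    · simp [hne]
  | _ => exact le_rfl

theorem Step.of_invoke {cmd : Cmd n O} (h : Step C (.invoke cmd) C') :
    C.loc cmd.proc = .idle ∧ cmd.seq = C.seq cmd.proc + 1 ∧ C'.seq cmd.proc = cmd.seq ∧
      C'.loc cmd.proc = .collect cmd (fun _ => none) ∧
      (∀ i, i ≠ cmd.proc → C'.loc i = C.loc i) ∧ C'.S = C.S ∧ C'.gca = C.gca := by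
  cases h with
  | invoke i op h =>
    refine ⟨h, rfl, by simp, by simp, fun i' hi' => ?_, rfl, rfl⟩
    exact Function.update_of_ne hi' _ _

/-- A pending command after a step was pending before, or is invoked in this step. -/
theorem Step.pending_cases (h : Step C l C') {i : Fin n} {cmd : Cmd n O}
    (hi : (C'.loc i).pending = some cmd) :
    (C.loc i).pending = some cmd ∨ (l = .invoke cmd ∧ cmd.proc = i) := by
  cases h with
  | idle => exact Or.inl hi
  | invoke i₀ op h =>
    rcases eq_or_ne i i₀ with rfl | hne
    · simp only [Function.update_self, Loc.pending, Option.some.injEq] at hi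
      subst hi
      exact Or.inr ⟨rfl, rfl⟩
    · simp only [Function.update_of_ne hne] at hi
      exact Or.inl hi
  | read i₀ _ _ _ h _ | select i₀ _ _ _ h _ | propose i₀ _ _ _ _ h _
  | gcaReturn i₀ _ _ _ _ _ h _ _ | write i₀ _ _ _ _ h _ | respond i₀ _ _ _ h _ =>
    rcases eq_or_ne i i₀ with rfl | hne
    · simp only [Function.update_self, Loc.pending, reduceCtorEq] at hi
      try exact Or.inl (by rw [h]; exact hi)
    · simp only [Function.update_of_ne hne] at hi
      exact Or.inl hi

theorem Step.of_respond {i : Fin n} {ρ : R} (h : Step C (.respond i ρ) C') :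
    ∃ cmd s, C.loc i = .done cmd s ∧ (A.cmdObject n).RetTrace s cmd 1 ρ := by
  cases h with
  | respond i₀ cmd s ρ h hρ => exact ⟨cmd, s, h, hρ⟩

theorem Config.Source.exists_mem {r : ℕ} {s : CTrace A n} (h : C.Source r s)
    (hs : (C.gca r).SafetySpec) {o : Cmd n O} (ho : o ∈ s.ops) :
    ∃ i x, (C.gca r).inp i = some x ∧ o ∈ x.ops := by
  rcases h with ⟨-, rfl⟩ | ⟨j, c, hj⟩
  · rw [SeqObject.Trace.ops_one] at ho
    simp at ho
  · exact hs.exists_mem hj ho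

theorem Config.Source.nodup {r : ℕ} {s : CTrace A n} (h : C.Source r s)
    (hs : (C.gca r).SafetySpec) (hn : ∀ i x, (C.gca r).inp i = some x → x.ops.Nodup) :
    s.ops.Nodup := by
  classical
  rcases h with ⟨-, rfl⟩ | ⟨j, c, hj⟩
  · rw [SeqObject.Trace.ops_one]
    exact Multiset.nodup_zero
  · rw [Multiset.nodup_iff_count_le_one]
    intro o
    obtain ⟨i, x, hi, hx⟩ := hs.validity j s c hj o
    exact hx.trans (Multiset.nodup_iff_count_le_one.1 (hn i x hi) o)

/-- The register `S[j]` contains at least the round `r`, the process that executes `cmd` has reached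
at least the round `r`, and `cmd` has not been proposed at the rounds up to `r`. -/
structure Config.Late (C : Config A n) (r : ℕ) (j : Fin n) (cmd : Cmd n O) : Prop where
  stored : r ≤ (C.S j).1
  view : ∀ i view x, C.loc i = .collect cmd view → view j = some x → r ≤ x.1
  loop : ∀ i r' s c, C.loc i = .loop cmd r' s c → r ≤ r'
  call : ∀ i r', C.loc i = .inGCA cmd r' → r ≤ r'
  absent : ∀ r' ≤ r, ∀ i x, (C.gca r').inp i = some x → cmd ∉ x.ops

/-- Rounds in registers do not decrease, so reading `S[j]` for `cmd` yields at least `r`, and so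
does the maximum selected. Hence `cmd` is appended only at rounds above `r`, and by validity no
trace with `cmd` reaches a lower round in another way. -/
theorem Step.late (h : Step C l C') (hC : ∀ i, C.OneShot i) (hs : ∀ r, (C.gca r).SafetySpec)
    (hp : C.Provenance) {r : ℕ} {j : Fin n} {cmd : Cmd n O} (hl : l ≠ .invoke cmd)
    (hlate : C.Late r j cmd) : C'.Late r j cmd := by
  have hS := hlate.stored.trans (h.round_S_mono (hC j))
  have habs : ∀ r' ≤ r, ∀ i x, (C'.gca r').inp i = some x → cmd ∉ x.ops := by
    intro r' hr' i x hx hmem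
    rcases h.inp_cases hx with hx | ⟨cmd', r'', s, c, rfl, hi, rfl⟩
    · exact hlate.absent r' hr' i x hx hmem
    · rcases mem_proposal.1 hmem with hmem | rfl
      · obtain ⟨i', x, hx, hmem⟩ := (hp.loop _ _ _ _ _ hi).1.exists_mem (hs r'') hmem
        exact hlate.absent r'' (by omega) i' x hx hmem
      · have := hlate.loop _ _ _ _ hi
        omega
  have hview := hlate.view
  have hloop := hlate.loop
  have hcall := hlate.call
  cases h with
  | idle => exact hlate
  | invoke i₀ op h =>
    refine ⟨hS, ?_, ?_, ?_, habs⟩ <;> intro i <;> rcases eq_or_ne i i₀ with rfl | hne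
    · intro view x h1 h2
      simp only [Function.update_self, Loc.collect.injEq] at h1
      exact absurd (congrArg Label.invoke h1.1) hl
    · simpa only [Function.update_of_ne hne] using hview i
    · simp
    · simpa only [Function.update_of_ne hne] using hloop i
    · simp
    · simpa only [Function.update_of_ne hne] using hcall i
  | read i₀ j₀ cmd' view h hj =>
    refine ⟨hS, ?_, ?_, ?_, habs⟩ <;> intro i <;> rcases eq_or_ne i i₀ with rfl | hne
    · intro view' x h1 h2
      simp only [Function.update_self, Loc.collect.injEq] at h1
      obtain ⟨rfl, rfl⟩ := h1
      rcases eq_or_ne j j₀ with rfl | hij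
      · simp only [Function.update_self, Option.some.injEq] at h2
        rw [← h2]
        exact hS
      · rw [Function.update_of_ne hij] at h2
        exact hview _ _ _ h h2
    · simpa only [Function.update_of_ne hne] using hview i
    · simp
    · simpa only [Function.update_of_ne hne] using hloop i
    · simp
    · simpa only [Function.update_of_ne hne] using hcall i
  | select i₀ j₀ cmd' view h hmax =>
    refine ⟨hS, ?_, ?_, ?_, habs⟩ <;> intro i <;> rcases eq_or_ne i i₀ with rfl | hne
    · simp
    · simpa only [Function.update_of_ne hne] using hview i
    · intro r' s c h1
      simp only [Function.update_self, Loc.loop.injEq] at h1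
      obtain ⟨rfl, rfl, -, -⟩ := h1
      exact (hview _ _ _ h rfl).trans (hmax j)
    · simpa only [Function.update_of_ne hne] using hloop i
    · simp
    · simpa only [Function.update_of_ne hne] using hcall i
  | propose i₀ cmd' r' s c h hc =>
    refine ⟨hS, ?_, ?_, ?_, habs⟩ <;> intro i <;> rcases eq_or_ne i i₀ with rfl | hne
    · simp
    · simpa only [Function.update_of_ne hne] using hview i
    · simp
    · simpa only [Function.update_of_ne hne] using hloop i
    · intro r'' h1
      simp only [Function.update_self, Loc.inGCA.injEq] at h1
      obtain ⟨rfl, rfl⟩ := h1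
      exact (hloop _ _ _ _ h).trans (Nat.le_succ _)
    · simpa only [Function.update_of_ne hne] using hcall i
  | gcaReturn i₀ cmd' r' t c g h hg hspec =>
    refine ⟨hS, ?_, ?_, ?_, habs⟩ <;> intro i <;> rcases eq_or_ne i i₀ with rfl | hne
    · simp
    · simpa only [Function.update_of_ne hne] using hview i
    · intro r'' s' c' h1
      simp only [Function.update_self, Loc.loop.injEq] at h1
      obtain ⟨rfl, rfl, -, -⟩ := h1
      exact hcall _ _ h
    · simpa only [Function.update_of_ne hne] using hloop i
    · simp
    · simpa only [Function.update_of_ne hne] using hcall i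
  | write i₀ cmd' r' s c h hc =>
    refine ⟨hS, ?_, ?_, ?_, habs⟩ <;> intro i <;> rcases eq_or_ne i i₀ with rfl | hne
    · simp
    · simpa only [Function.update_of_ne hne] using hview i
    · simp
    · simpa only [Function.update_of_ne hne] using hloop i
    · simp
    · simpa only [Function.update_of_ne hne] using hcall i
  | respond i₀ cmd' s ρ h hρ =>
    refine ⟨hS, ?_, ?_, ?_, habs⟩ <;> intro i <;> rcases eq_or_ne i i₀ with rfl | hne
    · simp
    · simpa only [Function.update_of_ne hne] using hview i
    · simp
    · simpa only [Function.update_of_ne hne] using hloop i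
    · simp
    · simpa only [Function.update_of_ne hne] using hcall i

/-! ### Executions -/

namespace Execution

variable (α : Execution A n)

theorem oneShot (k : ℕ) (i : Fin n) : (α.config k).OneShot i := by
  induction k with
  | zero =>
    rw [α.start]
    exact Config.oneShot_initial i
  | succ k ih => exact (α.step k).oneShot ih

theorem safetySpec (k r : ℕ) : ((α.config k).gca r).SafetySpec := by
  induction k generalizing r with
  | zero =>
    rw [α.start]
    exact ⟨fun _ _ _ h => (nomatch h), fun _ _ _ _ _ h => (nomatch h), fun _ _ _ _ _ h => nomatch h⟩
  | succ k ih => exact (α.step k).safetySpec (α.oneShot k) ih r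

theorem provenance (k : ℕ) : (α.config k).Provenance := by
  induction k with
  | zero =>
    rw [α.start]
    exact Config.provenance_initial
  | succ k ih => exact (α.step k).provenance (α.oneShot k) ih

variable {α}

theorem out_mono {k k' : ℕ} (hk : k ≤ k') {r : ℕ} {i : Fin n} {p : CTrace A n × Bool}
    (h : ((α.config k).gca r).out i = some p) : ((α.config k').gca r).out i = some p := by
  induction k', hk using Nat.le_induction with
  | base => exact h
  | succ k' _ ih => exact (α.step k').out_mono (α.oneShot k' i) ih

theorem round_S_mono {k k' : ℕ} (hk : k ≤ k') (i : Fin n) :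
    ((α.config k).S i).1 ≤ ((α.config k').S i).1 := by
  induction k', hk using Nat.le_induction with
  | base => exact le_rfl
  | succ k' _ ih => exact ih.trans ((α.step k').round_S_mono (α.oneShot k' i))

theorem seq_mono {k k' : ℕ} (hk : k ≤ k') (i : Fin n) :
    (α.config k).seq i ≤ (α.config k').seq i := by
  induction k', hk using Nat.le_induction with
  | base => exact le_rfl
  | succ k' _ ih => exact ih.trans ((α.step k').seq_mono i)

theorem step_of_label {k : ℕ} {l : Label A n} (h : α.label k = l) :
    Step (α.config k) l (α.config (k + 1)) := h ▸ α.step k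

theorem out_of_label {k r : ℕ} {i : Fin n} {t : CTrace A n} {c : Bool}
    (h : α.label k = .gcaReturn i r t c) : ((α.config (k + 1)).gca r).out i = some (t, c) :=
  (step_of_label h).out_of_gcaReturn

theorem label_of_out {k r : ℕ} {i : Fin n} {t : CTrace A n} {c : Bool}
    (h : ((α.config k).gca r).out i = some (t, c)) : ∃ k', α.label k' = .gcaReturn i r t c := by
  induction k with
  | zero =>
    rw [α.start] at h
    cases h
  | succ k ih =>
    rcases (α.step k).out_cases h with h | ⟨h, -⟩
    · exact ih h
    · exact ⟨k, h⟩

theorem Committed.returned {r : ℕ} {t : CTrace A n} (h : α.Committed r t) : α.Returned r t := by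
  obtain ⟨k, i, h⟩ := h
  exact ⟨k, i, true, h⟩

theorem Committed.le {r r' : ℕ} {t t' : CTrace A n} (ht : α.Committed r t)
    (ht' : α.Returned r' t') (hr : r ≤ r') : t ≤ t' := by
  obtain ⟨k, i, hk⟩ := ht
  obtain ⟨k', j, c, hk'⟩ := ht'
  exact Config.le_of_committed (α.safetySpec (max (k + 1) (k' + 1))) (α.provenance _) hr
    (out_mono (le_max_left _ _) (out_of_label hk)) (out_mono (le_max_right _ _) (out_of_label hk'))

theorem Committed.unique {r : ℕ} {t t' : CTrace A n} (h : α.Committed r t)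
    (h' : α.Committed r t') : t = t' :=
  le_antisymm (h.le h'.returned le_rfl) (h'.le h.returned le_rfl)

theorem Committed.pos {r : ℕ} {t : CTrace A n} (h : α.Committed r t) : 0 < r := by
  obtain ⟨k, i, hk⟩ := h
  exact (α.provenance (k + 1)).pos r i _ (out_of_label hk)

theorem seq_of_invoke {k k' : ℕ} {cmd : Cmd n O} (h : α.label k = .invoke cmd) (hk : k < k') :
    cmd.seq ≤ (α.config k').seq cmd.proc := by
  rw [← (step_of_label h).of_invoke.2.2.1]
  exact seq_mono hk _

/-- The sequence number of a process grows with each of its invocations, so a command identifies an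
operation instance. -/
theorem invoke_unique {k k' : ℕ} {cmd : Cmd n O} (h : α.label k = .invoke cmd)
    (h' : α.label k' = .invoke cmd) : k = k' := by
  have key : ∀ {k k' : ℕ}, α.label k = .invoke cmd → α.label k' = .invoke cmd → ¬ k < k' := by
    intro k k' h h' hlt
    have h1 := seq_of_invoke h hlt
    have h2 := (step_of_label h').of_invoke.2.1
    omega
  exact le_antisymm (not_lt.1 (key h' h)) (not_lt.1 (key h h'))

theorem invoked_of_pending {k : ℕ} {i : Fin n} {cmd : Cmd n O}
    (h : ((α.config k).loc i).pending = some cmd) :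
    cmd.proc = i ∧ ∃ k' < k, α.label k' = .invoke cmd := by
  induction k with
  | zero =>
    rw [α.start] at h
    cases h
  | succ k ih =>
    rcases (α.step k).pending_cases h with h | ⟨h, hi⟩
    · obtain ⟨h1, k', h2, h3⟩ := ih h
      exact ⟨h1, k', by omega, h3⟩
    · exact ⟨hi, k, by omega, h⟩

/-- A command enters a proposal either from its own process, where it is pending, or from a source,
which by validity has it from an earlier input. -/
theorem invoked_of_mem_inp {k r : ℕ} {i : Fin n} {x : CTrace A n}
    (h : ((α.config k).gca r).inp i = some x) {cmd : Cmd n O} (hmem : cmd ∈ x.ops) :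
    ∃ k' < k, α.label k' = .invoke cmd := by
  induction k generalizing r i x with
  | zero =>
    rw [α.start] at h
    cases h
  | succ k ih =>
    have hlt : (∃ k' < k, α.label k' = .invoke cmd) → ∃ k' < k + 1, α.label k' = .invoke cmd :=
      fun ⟨k', h1, h2⟩ => ⟨k', by omega, h2⟩
    rcases (α.step k).inp_cases h with h | ⟨cmd', r', s, c, rfl, hi, rfl⟩
    · exact hlt (ih h hmem)
    · rcases mem_proposal.1 hmem with hmem | rfl
      · obtain ⟨i', x, hx, hmem⟩ :=
          ((α.provenance k).loop _ _ _ _ _ hi).1.exists_mem (α.safetySpec k r') hmem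
        exact hlt (ih hx hmem)
      · exact hlt (invoked_of_pending (i := i) (by rw [hi]; rfl)).2

/-- By validity, an operation is at most as frequent in an output as in some single input, so
merging inputs creates no duplicates; a process appends its command only if it is absent. -/
theorem nodup_inp {k r : ℕ} {i : Fin n} {x : CTrace A n}
    (h : ((α.config k).gca r).inp i = some x) : x.ops.Nodup := by
  induction k generalizing r i x with
  | zero =>
    rw [α.start] at h
    cases h
  | succ k ih =>
    rcases (α.step k).inp_cases h with h | ⟨cmd', r', s, c, rfl, hi, rfl⟩
    · exact ih h
    · exact nodup_proposal _ (((α.provenance k).loop _ _ _ _ _ hi).1.nodup (α.safetySpec k r')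
        fun i x => ih)

theorem Returned.nodup {r : ℕ} {t : CTrace A n} (h : α.Returned r t) : t.ops.Nodup := by
  obtain ⟨k, i, c, h⟩ := h
  exact Config.Source.nodup (Or.inr ⟨i, c, out_of_label h⟩) (α.safetySpec _ _) fun _ _ => nodup_inp

theorem Returned.invoked {r : ℕ} {t : CTrace A n} (h : α.Returned r t) {cmd : Cmd n O}
    (hmem : cmd ∈ t.ops) : ∃ k, α.label k = .invoke cmd := by
  obtain ⟨k, i, c, h⟩ := h
  obtain ⟨i', x, hx, hmem⟩ := (α.safetySpec _ _).exists_mem (out_of_label h) hmem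
  obtain ⟨k', -, h'⟩ := invoked_of_mem_inp hx hmem
  exact ⟨k', h'⟩

/-- If a command is invoked when a register contains the round `r`, then it is absent from all
traces returned at the rounds up to `r`. -/
theorem Returned.not_mem {r' : ℕ} {t : CTrace A n} (h : α.Returned r' t) {k r : ℕ} (hr : r' ≤ r)
    {j : Fin n} {cmd : Cmd n O} (hk : α.label k = .invoke cmd)
    (hj : r ≤ ((α.config k).S j).1) : cmd ∉ t.ops := by
  -- Right after the invocation the view is empty and no input contains `cmd`, since inputs consist
  -- of commands invoked before. As `cmd` is never invoked again, `Step.late` applies from then on.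
  have hlate : ∀ k' ≥ k + 1, (α.config k').Late r j cmd := by
    intro k' hk'
    induction k', hk' using Nat.le_induction with
    | base =>
      obtain ⟨h1, h2, h3, h4, h5, h6, h7⟩ := (step_of_label hk).of_invoke
      have hold : ∀ i, ((α.config (k + 1)).loc i).pending = some cmd → i = cmd.proc :=
        fun i hi => (invoked_of_pending hi).1.symm
      refine ⟨by rwa [h6], ?_, ?_, ?_, ?_⟩
      · intro i view x h8 h9
        obtain rfl := hold i (by rw [h8]; rfl)
        rw [h4, Loc.collect.injEq] at h8
        rw [← h8.2] at h9
        cases h9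
      · intro i r' s c h8
        obtain rfl := hold i (by rw [h8]; rfl)
        rw [h4] at h8
        cases h8
      · intro i r' h8
        obtain rfl := hold i (by rw [h8]; rfl)
        rw [h4] at h8
        cases h8
      · intro r' _ i x hx hmem
        rw [h7] at hx
        obtain ⟨k', hlt, hk'⟩ := invoked_of_mem_inp hx hmem
        exact hlt.ne (invoke_unique hk' hk)
    | succ k' hk' ih =>
      refine (α.step k').late (α.oneShot k') (α.safetySpec k') (α.provenance k') ?_ ih
      intro hl
      have := invoke_unique hk hl
      omega
  obtain ⟨m, i, c, hm⟩ := h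
  intro hmem
  have hout := out_mono (le_max_left (m + 1) (k + 1)) (out_of_label hm)
  obtain ⟨i', x, hx, hmem⟩ := (α.safetySpec _ _).exists_mem hout hmem
  exact (hlate _ (le_max_right _ _)).absent r' hr i' x hx hmem

/-! ### Histories of executions -/

theorem history_inv {k : ℕ} {i : Fin n} {o : O} :
    α.history k = some (.inv i o) ↔ ∃ cmd, α.label k = .invoke cmd ∧ cmd.proc = i ∧ cmd.op = o := by
  unfold history
  cases α.label k <;> simp [Label.event]

theorem history_res {k : ℕ} {i : Fin n} {ρ : R} :
    α.history k = some (.res i ρ) ↔ α.label k = .respond i ρ := by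
  unfold history
  cases α.label k <;> simp [Label.event]

theorem history_of_invoke {k : ℕ} {cmd : Cmd n O} (h : α.label k = .invoke cmd) :
    α.history k = some (.inv cmd.proc cmd.op) := history_inv.2 ⟨cmd, h, rfl, rfl⟩

theorem pending_of_no_event {k m : ℕ} {cmd : Cmd n O} (h : α.label k = .invoke cmd) (hm : k < m)
    (hno : ∀ l, k < l → l < m → ∀ e, α.history l = some e → e.proc ≠ cmd.proc) :
    ((α.config m).loc cmd.proc).pending = some cmd := by
  induction m, hm using Nat.le_induction with
  | base =>
    rw [(step_of_label h).of_invoke.2.2.2.1]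
    rfl
  | succ m hm ih =>
    exact (α.step m).pending (ih fun l h1 h2 => hno l h1 (by omega)) (hno m hm (by omega))

/-- A response is given after the write, so at time `m` the register of the process holds the round
at which the trace used for the response is committed. -/
theorem committed_of_completes {k m : ℕ} {cmd : Cmd n O} {ρ : R} (h : α.label k = .invoke cmd)
    (hm : α.history.Completes k m ρ) : ∃ r s, α.Committed r s ∧ cmd ∈ s.ops ∧
      (A.cmdObject n).RetTrace s cmd 1 ρ ∧ ((α.config m).S cmd.proc).1 = r := by
  obtain ⟨i, o, h1, h2, hlt, hno⟩ := hm
  rw [history_of_invoke h] at h1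
  obtain ⟨rfl, -⟩ : cmd.proc = i ∧ cmd.op = o := by simpa using h1
  have hp := pending_of_no_event h hlt hno
  obtain ⟨cmd', s, hloc, hret⟩ := (step_of_label (history_res.1 h2)).of_respond
  rw [hloc] at hp
  obtain rfl : cmd' = cmd := by simpa [Loc.pending] using hp
  obtain ⟨-, hmem, j, hj⟩ := (α.provenance m).done _ _ _ hloc
  obtain ⟨k', hk'⟩ := label_of_out hj
  exact ⟨_, s, ⟨k', j, hk'⟩, hmem, hret, rfl⟩

/-- Instances of the same process do not overlap. -/
theorem precedes_of_proc_eq {k k' : ℕ} {cmd cmd' : Cmd n O} (h : α.label k = .invoke cmd)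
    (h' : α.label k' = .invoke cmd') (hproc : cmd.proc = cmd'.proc) (hlt : k < k') :
    α.history.Precedes k k' := by
  classical
  -- The first event of the process after `k` is a response: until then `cmd` is pending, while an
  -- invocation needs an idle process.
  have hex : ∃ l, k < l ∧ ∃ e, α.history l = some e ∧ e.proc = cmd.proc :=
    ⟨k', hlt, _, history_of_invoke h', hproc.symm⟩
  obtain ⟨hl, e, he, hep⟩ := Nat.find_spec hex
  have hle : Nat.find hex ≤ k' := Nat.find_min' hex ⟨hlt, _, history_of_invoke h', hproc.symm⟩
  have hmin : ∀ l, k < l → l < Nat.find hex → ∀ e, α.history l = some e → e.proc ≠ cmd.proc :=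
    fun l h1 h2 e h3 h4 => Nat.find_min hex h2 ⟨h1, e, h3, h4⟩
  have hp := pending_of_no_event h hl hmin
  generalize Nat.find hex = m at *
  cases e with
  | inv i o =>
    obtain ⟨cmd'', h1, rfl, -⟩ := history_inv.1 he
    have h2 := (step_of_label h1).of_invoke.1
    change cmd''.proc = cmd.proc at hep
    rw [hep] at h2
    rw [h2] at hp
    cases hp
  | res i ρ =>
    obtain rfl : i = cmd.proc := hep
    refine ⟨m, ρ, ⟨_, _, history_of_invoke h, he, hl, hmin⟩, lt_of_le_of_ne hle ?_,
      _, _, history_of_invoke h'⟩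
    rintro rfl
    rw [history_of_invoke h'] at he
    cases he

end Execution

end Algorithm

/-! ### Chains of schedules -/

theorem prefix_of_chain {X : Type*} {L : ℕ → List X} (hL : ∀ r, L r <+: L (r + 1)) {r r' : ℕ}
    (hr : r ≤ r') : L r <+: L r' := by
  induction r', hr using Nat.le_induction with
  | base => exact List.prefix_rfl
  | succ r' _ ih => exact ih.trans (hL r')

theorem getElem?_of_prefix {X : Type*} {l l' : List X} (h : l <+: l') {p : ℕ} {c : X}
    (hp : l[p]? = some c) : l'[p]? = some c := by
  obtain ⟨z, rfl⟩ := h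
  rw [List.getElem?_append_left (List.getElem?_eq_some_iff.1 hp).1, hp]

/-- The finite or infinite sequence approximated by a chain of lists. -/
theorem exists_limit_of_chain {X : Type*} {L : ℕ → List X} (hL : ∀ r, L r <+: L (r + 1)) :
    ∃ f : ℕ → Option X, ∀ p c, f p = some c ↔ ∃ r, (L r)[p]? = some c := by
  classical
  refine ⟨fun p => if h : ∃ c r, (L r)[p]? = some c then some h.choose else none, fun p c => ?_⟩
  constructor
  · intro h
    dsimp only at h
    split_ifs at h with h'
    · obtain rfl := Option.some.inj h
      exact h'.choose_spec
  · rintro ⟨r, hr⟩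
    have h' : ∃ c r, (L r)[p]? = some c := ⟨c, r, hr⟩
    dsimp only
    rw [dif_pos h', Option.some.injEq]
    obtain ⟨r', hr'⟩ := h'.choose_spec
    exact Option.some.inj
      ((getElem?_of_prefix (prefix_of_chain hL (le_max_right r r')) hr').symm.trans
        (getElem?_of_prefix (prefix_of_chain hL (le_max_left r r')) hr))

section Algorithm

variable {Q O R : Type*} {A : SeqObject Q O R} {n : ℕ}

/-! ### Schedules of the committed traces and their limit -/

namespace Execution

variable (α : Execution A n)

/-- A chain of representatives of the committed traces: `L r` represents the last trace committed
up to the round `r`. -/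
structure CommitChain (L : ℕ → List (Cmd n O)) : Prop where
  prefix_succ : ∀ r, L r <+: L (r + 1)
  eq_of_committed : ∀ r t, α.Committed r t → (A.cmdObject n).traceOf (L r) = t
  committed : ∀ r, L r = [] ∨ ∃ r' ≤ r, α.Committed r' ((A.cmdObject n).traceOf (L r))

/-- If round `r + 1` commits a trace, it extends the last committed one, and a representative of the
remainder is appended; otherwise the schedule stays. All traces committed at one round are equal, so
the choice does not matter. -/
theorem exists_commitChain : ∃ L, α.CommitChain L := by
  let P : ℕ → List (Cmd n O) → Prop := fun r l =>
    l = [] ∨ ∃ r' ≤ r, α.Committed r' ((A.cmdObject n).traceOf l)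
  have step : ∀ r l, P r l → ∃ l', P (r + 1) l' ∧ l <+: l' ∧
      ∀ t, α.Committed (r + 1) t → (A.cmdObject n).traceOf l' = t := by
    intro r l hl
    by_cases h : ∃ t, α.Committed (r + 1) t
    · obtain ⟨t, ht⟩ := h
      have hle : (A.cmdObject n).traceOf l ≤ t := by
        rcases hl with rfl | ⟨r', hr', hl⟩
        · exact SeqObject.Trace.one_le t
        · exact hl.le ht.returned (by omega)
      obtain ⟨z, hz⟩ := hle
      obtain ⟨z, rfl⟩ := SeqObject.Trace.exists_traceOf z
      rw [SeqObject.Trace.mk_mul_mk] at hz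
      refine ⟨l ++ z, Or.inr ⟨r + 1, le_rfl, hz ▸ ht⟩, List.prefix_append _ _, fun t' ht' => ?_⟩
      rw [← hz]
      exact ht.unique ht'
    · exact ⟨l, hl.imp id fun ⟨r', h1, h2⟩ => ⟨r', by omega, h2⟩, List.prefix_rfl,
        fun t ht => absurd ⟨t, ht⟩ h⟩
  choose! F h1 h2 h3 using step
  let L : ℕ → List (Cmd n O) := fun r => Nat.rec [] (fun r l => F r l) r
  have hP : ∀ r, P r (L r) := by
    intro r
    induction r with
    | zero => exact Or.inl rfl
    | succ r ih => exact h1 r _ ih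
  refine ⟨L, fun r => h2 r _ (hP r), fun r t ht => ?_, hP⟩
  obtain ⟨r, rfl⟩ := Nat.exists_eq_succ_of_ne_zero ht.pos.ne'
  exact h3 r _ (hP r) t ht

namespace CommitChain

variable {α} {L : ℕ → List (Cmd n O)} (hL : α.CommitChain L)
include hL

theorem nodup (r : ℕ) : (L r).Nodup := by
  rcases hL.committed r with h | ⟨r', -, h⟩
  · rw [h]
    exact List.nodup_nil
  · exact h.returned.nodup

theorem exists_returned {r : ℕ} {cmd : Cmd n O} (h : cmd ∈ L r) :
    ∃ r' ≤ r, ∃ t, α.Returned r' t ∧ cmd ∈ t.ops := by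
  rcases hL.committed r with h' | ⟨r', hr', h'⟩
  · rw [h'] at h
    cases h
  · exact ⟨r', hr', _, h'.returned, h⟩

theorem invoked {r : ℕ} {cmd : Cmd n O} (h : cmd ∈ L r) : ∃ k, α.label k = .invoke cmd := by
  obtain ⟨r', -, t, ht, hmem⟩ := hL.exists_returned h
  exact ht.invoked hmem

theorem mem_of_committed {r : ℕ} {t : CTrace A n} (ht : α.Committed r t) {cmd : Cmd n O}
    (h : cmd ∈ t.ops) : cmd ∈ L r := by
  rw [← hL.eq_of_committed r t ht] at h
  exact h

/-- The register written before the response to `cmd` keeps `cmd'` out of all schedules up to round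
`r₁`, while `cmd` is in `L r₁`, a prefix of `L r`. -/
theorem prec_of_precedes {k k' r : ℕ} {cmd cmd' : Cmd n O} (h : α.label k = .invoke cmd)
    (h' : α.label k' = .invoke cmd') (hp : α.history.Precedes k k') (hmem : cmd' ∈ L r) :
    Prec (L r) cmd 1 cmd' 1 := by
  obtain ⟨m, ρ, hm, hlt, -⟩ := hp
  obtain ⟨r₁, s, hs, hcmd, -, hS⟩ := committed_of_completes h hm
  have habs : ∀ r' ≤ r₁, cmd' ∉ L r' := by
    intro r' hr' hmem'
    obtain ⟨r'', hr'', t, ht, hmem'⟩ := hL.exists_returned hmem'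
    exact ht.not_mem (hr''.trans hr') h' (hS ▸ round_S_mono hlt.le _) hmem'
  have hr : r₁ ≤ r := by
    by_contra hr
    exact habs r (by omega) hmem
  obtain ⟨p, hp⟩ := List.mem_iff_getElem?.1 (hL.mem_of_committed hs hcmd)
  obtain ⟨p', hp'⟩ := List.mem_iff_getElem?.1 hmem
  have hpre := prefix_of_chain hL.prefix_succ hr
  refine ⟨p, p', occursAt_one_of_nodup (hL.nodup r) (getElem?_of_prefix hpre hp),
    occursAt_one_of_nodup (hL.nodup r) hp', ?_⟩
  -- A position of `cmd'` not after that of `cmd` would lie within `L r₁`.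
  by_contra hlt'
  have hlen := (List.getElem?_eq_some_iff.1 hp).1
  have h1 : (L r₁)[p']? = some cmd' := by
    obtain ⟨z, hz⟩ := hpre
    rwa [← hz, List.getElem?_append_left (by omega)] at hp'
  exact habs r₁ le_rfl (List.mem_of_getElem? h1)

/-- The response is read off a trace committed at `r`, of which `L r` is a representative, and
extending a schedule keeps responses. The conclusion records the commitment so that `r` can be
compared with the last committed round. -/
theorem retSched_of_completes {k m : ℕ} {cmd : Cmd n O} {ρ : R} (h : α.label k = .invoke cmd)
    (hm : α.history.Completes k m ρ) : ∃ r t, α.Committed r t ∧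
      ∀ r' ≥ r, (A.cmdObject n).RetSched (L r') cmd 1 ρ := by
  obtain ⟨r, s, hs, -, hret, -⟩ := committed_of_completes h hm
  refine ⟨r, s, hs, fun r' hr' => ?_⟩
  rw [← hL.eq_of_committed r s hs] at hret
  exact hret.retSched.of_prefix (prefix_of_chain hL.prefix_succ hr')

/-- The limit of the chain, with its responses, is a linearization. -/
theorem linearizable : α.history.Linearizable A := by
  classical
  obtain ⟨f, hf⟩ := exists_limit_of_chain hL.prefix_succ
  -- The invocation time names the instance; commands outside the limit get the irrelevant value
  -- `0`.
  obtain ⟨time, htime⟩ : ∃ time : Cmd n O → ℕ, ∀ p c, f p = some c →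
      α.label (time c) = .invoke c := by
    have : ∀ c, ∃ k, ∀ p, f p = some c → α.label k = .invoke c := by
      intro c
      by_cases hc : ∃ p, f p = some c
      · obtain ⟨p, hp⟩ := hc
        obtain ⟨r, hr⟩ := (hf p c).1 hp
        obtain ⟨k, hk⟩ := hL.invoked (List.mem_of_getElem? hr)
        exact ⟨k, fun _ _ => hk⟩
      · exact ⟨0, fun p hp => absurd ⟨p, hp⟩ hc⟩
    choose time htime using this
    exact ⟨time, fun p c => htime c p⟩
  -- The states along the limit; after the end of a finite sequence the state stays constant.
  let q : ℕ → Q := fun p => Nat.rec A.init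
    (fun p q => ((f p).map fun c => (A.step c.op q).2).getD q) p
  have hq : ∀ p c, f p = some c → q (p + 1) = (A.step c.op (q p)).2 := by
    intro p c hp
    change ((f p).map fun c => (A.step c.op (q p)).2).getD (q p) = _
    rw [hp]
    rfl
  let S : ℕ → Option (ℕ × R) := fun p => (f p).map fun c => (time c, (A.step c.op (q p)).1)
  have hS : ∀ {p k ρ}, S p = some (k, ρ) →
      ∃ c, f p = some c ∧ α.label k = .invoke c ∧ (A.step c.op (q p)).1 = ρ := by
    intro p k ρ h
    obtain ⟨c, hc, h⟩ := Option.map_eq_some_iff.1 h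
    rw [Prod.mk.injEq] at h
    exact ⟨c, hc, h.1 ▸ htime p c hc, h.2⟩
  -- Any two entries of the limit occur together in one schedule of the chain, where their order can
  -- be compared.
  have hcommon : ∀ {p p' c c'}, f p = some c → f p' = some c' →
      ∃ r, (L r)[p]? = some c ∧ (L r)[p']? = some c' := by
    intro p p' c c' h h'
    obtain ⟨r, hr⟩ := (hf p c).1 h
    obtain ⟨r', hr'⟩ := (hf p' c').1 h'
    exact ⟨max r r', getElem?_of_prefix (prefix_of_chain hL.prefix_succ (le_max_left r r')) hr,
      getElem?_of_prefix (prefix_of_chain hL.prefix_succ (le_max_right r r')) hr'⟩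
  have hreal : ∀ p p' k k' ρ ρ', S p = some (k, ρ) → S p' = some (k', ρ') →
      α.history.Precedes k k' → p < p' := by
    intro p p' k k' ρ ρ' h h' hpre
    obtain ⟨c, hc, hk, -⟩ := hS h
    obtain ⟨c', hc', hk', -⟩ := hS h'
    obtain ⟨r, hr, hr'⟩ := hcommon hc hc'
    obtain ⟨x, y, hx, hy, hxy⟩ := hL.prec_of_precedes hk hk' hpre (List.mem_of_getElem? hr')
    rwa [hx.unique (occursAt_one_of_nodup (hL.nodup r) hr),
      hy.unique (occursAt_one_of_nodup (hL.nodup r) hr')] at hxy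
  refine ⟨S, ?_, ?_, ?_, ?_, ⟨q, rfl, ?_⟩, ?_, hreal⟩
  · intro p hp
    rw [Option.map_eq_none_iff] at hp ⊢
    rw [Option.eq_none_iff_forall_ne_some] at hp ⊢
    intro c hc
    obtain ⟨r, hr⟩ := (hf _ c).1 hc
    have hlen := (List.getElem?_eq_some_iff.1 hr).1
    -- A schedule with an entry at position `p + 1` also has one at `p`.
    exact hp _ ((hf p _).2 ⟨r, List.getElem?_eq_getElem (by omega)⟩)
  · intro p k ρ h
    obtain ⟨c, -, hk, -⟩ := hS h
    exact ⟨_, _, history_of_invoke hk⟩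
  · intro p p' k ρ ρ' h h'
    obtain ⟨c, hc, hk, -⟩ := hS h
    obtain ⟨c', hc', hk', -⟩ := hS h'
    obtain rfl : c = c' := by simpa using hk.symm.trans hk'
    obtain ⟨r, hr, hr'⟩ := hcommon hc hc'
    exact (occursAt_one_of_nodup (hL.nodup r) hr).unique (occursAt_one_of_nodup (hL.nodup r) hr')
  · intro k m ρ hm
    obtain ⟨i, o, hk, -⟩ := id hm
    obtain ⟨cmd, hk, -, -⟩ := history_inv.1 hk
    obtain ⟨r, t, -, hret⟩ := hL.retSched_of_completes hk hm
    obtain ⟨p, q', hp, hrun⟩ := hret r le_rfl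
    have hfp : f p = some cmd := (hf p cmd).2 ⟨r, hp.1⟩
    have h1 := SeqObject.run_getElem? (A := A.cmdObject n) (s := L r) (q := q)
      (fun p c hc => hq p c ((hf p c).2 ⟨r, hc⟩)) hp.1
    have h2 : A.step cmd.op (q p) = (ρ, q') := Option.some.inj (h1.symm.trans hrun)
    refine ⟨p, ?_⟩
    change (f p).map _ = _
    rw [hfp, Option.map_some, h2, invoke_unique (htime p cmd hfp) hk]
  · intro p k ρ i o h hk
    obtain ⟨c, hc, hk', h1⟩ := hS h
    rw [history_of_invoke hk'] at hk
    obtain ⟨-, rfl⟩ : c.proc = i ∧ c.op = o := by simpa using hk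
    rw [hq p c hc, ← h1]
  · intro p p' k k' ρ ρ' i o o' h h' hk hk' hlt
    obtain ⟨c, hc, rfl, -⟩ := history_inv.1 hk
    obtain ⟨c', hc', hproc, -⟩ := history_inv.1 hk'
    -- Program order is a case of real-time order, as instances of one process do not overlap.
    exact hreal p p' k k' ρ ρ' h h' (precedes_of_proc_eq hc hc' hproc.symm hlt)

end CommitChain

end Execution

end Algorithm

end ChainedGCA

theorem mainTheorem4 {Q O R : Type*} (A : ChainedGCA.SeqObject Q O R) (n : ℕ)
    (α : ChainedGCA.Execution A n) :
    -- the history of the execution is linearizable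
    α.history.Linearizable A ∧
    -- a committed trace is a prefix of all traces returned at the same or later rounds
    (∀ r r' t t', r ≤ r' → α.Committed r t → α.Returned r' t' → t ≤ t') ∧
    -- the last committed trace has a real-time-respecting representative with all responses
    (∀ r t, α.Committed r t → (∀ r' t', α.Committed r' t' → r' ≤ r) →
      ∃ l : List (ChainedGCA.Cmd n O), (A.cmdObject n).traceOf l = t ∧ l.Nodup ∧
        (∀ cmd ∈ l, ∃ k, α.label k = .invoke cmd) ∧
        (∀ k k' cmd cmd', α.label k = .invoke cmd → α.label k' = .invoke cmd' →
          α.history.Precedes k k' → cmd' ∈ l → ChainedGCA.Prec l cmd 1 cmd' 1) ∧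
        (∀ k m cmd ρ, α.label k = .invoke cmd → α.history.Completes k m ρ →
          (A.cmdObject n).RetSched l cmd 1 ρ)) := by
  obtain ⟨L, hL⟩ := α.exists_commitChain
  refine ⟨hL.linearizable, fun r r' t t' hr ht ht' => ht.le ht' hr, fun r t ht hmax =>
    ⟨L r, hL.eq_of_committed r t ht, hL.nodup r, fun cmd => hL.invoked,
      fun k k' cmd cmd' => hL.prec_of_precedes, fun k m cmd ρ hk hm => ?_⟩⟩
  -- The response is fixed from some committed round on, and by maximality that round is at most
  -- `r`.
  obtain ⟨r', t', ht', hret⟩ := hL.retSched_of_completes hk hm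
  exact hret r (hmax r' t' ht')
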